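/- **Queue.** Let $J,\mathsf K\ge 1$ and let $\mathcal S_{\mathsf K}=\{s\in\mathbb Z_{\ge0}^J:\sum_j s_j\le \mathsf K\}$ be the set of schedules. Message class $j$ has an alphabet of size $M_j\ge 1$ and a tolerable error probability $p_{e,j}\in(0,1]$. With a parameter $0<\rho\le 1$, a class-$j$ message has service requirement $S_j=-\ln p_{e,j}+\rho\ln M_j$, assumed positive. Under schedule $s$ each scheduled class-$j$ message is offered the service quantum $\phi_j(s)$ (given below; $\phi_j(s)=0$ if $s_j=0$) in a time-slot. A state $\alpha$ lists, for each $j$, the residual requirements $x_j(1),\dots,x_j(n_j(\alpha))$ of the class-$j$ messages present, head of the queue first; each is a positive number of the form $S_j-\sum_{i=1}^m\phi_j(s^i)$ with $m\ge 0$ and $s^i\in\mathcal S_{\mathsf K}$. Put $n(\alpha)=\sum_j n_j(\alpha)$. In each slot a schedule $s$ that is feasible ($s_j\le n_j(\alpha)$ for all $j$) is implemented: the first $s_j$ messages of queue $j$ have their residual requirements reduced by $\phi_j(s)$, and those whose residual is then $\le 0$ leave. After that $A_j$ new messages with requirement $S_j$ join the end of queue $j$. The batch sizes $A_1,\dots,A_J$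 are independent of each other and of the state and schedule, i.i.d. over slots, with $\mathbb E A_j^2<\infty$. The state-independent policy $\omega$ with schedule distribution $p^\omega$ on $\mathcal S_{\mathsf K}$ draws $s\sim p^\omega$ independently of the state and of the arrivals, and implements the maximal sub-schedule $\left(\min\{s_j,n_j(\alpha)\}\right)_{j}$. **Independent decoding.** The service quantum is that of one of the following two channels. (a) *Discrete memoryless multiaccess channel.* There are finite input alphabets $\mathcal X_j$ with probability assignments $Q_j$, a finite output alphabet $\mathcal Y$, and for each $s$ a transition law $p^s(y\mid x^s)$, where $x^s=(x_j^k)_{1\le k\le s_j}$. For $s_j>0$, $$\phi_j(s)=E_{o,j}^s(\rho,Q_j)=-\ln\sum_{y}\Big[\sum_{x_j}Q_j(x_j)\,p_j^s(y\mid x_j)^{\frac1{1+\rho}}\Big]^{1+\rho},$$ where $p_j^s(y\mid x_j)$ is obtained from $p^s(y\mid x^s)$ by fixing $x_j^1=x_j$ and averaging over all other coordinates $x_l^k$, drawn independently from $Q_l$. It is assumed that $\phi_j(s)>0$ whenever $s_j>0$, and that fewer interferers do not hurt: $\phi_j(t)\ge\phi_j(s)$ whenever $t_i\le s_i$ for all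 $i$ and $t_j=s_j$. (b) *Gaussian encoding.* For $s_j>0$, $$\phi_j(s)=\rho\ln\Big(1+\frac{P_j}{(1+\rho)\left[\sum_k s_kP_k-P_j+N_0W\right]}\Big),\qquad P_j=|\gamma_j|^2P,$$ with $P,N_0,W>0$ and gains $\gamma_j\ne0$. Put $\overline\phi_j=\max_{s\in\mathcal S_{\mathsf K}}\phi_j(s)$ and $c(\alpha)=1+\sum_{j=1}^J\sum_{k=1}^{n_j(\alpha)}\left(x_j(k)+\overline\phi_j\right)$. **Statement.** Let $\mathcal X$ be a non-empty set of states that the resulting Markov chain $\{X_n\}$ cannot leave and on which it is irreducible, and consider the chain on the state space $\mathcal X$. If $$\left(S_j+\overline\phi_j\right)\mathbb E A_j<\sum_{s\in\mathcal S_{\mathsf K}}p^\omega(s)\,s_j\,\phi_j(s)\qquad\text{for }1\le j\le J,$$ then the chain is 1. *$c$-regular*: $\mathcal X$ is a countable union of sets $Y$ such that for every non-empty $Y'\subseteq\mathcal X$ $$\sup_{\alpha\in Y}\mathbb E_\alpha\Big[\sum_{n=0}^{\tau_{Y'}-1}c(X_n)\Big]<\infty,\qquad \tau_{Y'}=\min\{n\ge1:X_n\in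 Y'\};$$ 2. *stable*: it is positive recurrent (every state has finite expected return time), it has a stationary distribution, and the stationary mean of $n(\alpha)$ is finite. -/

import Mathlib

open MeasureTheory ProbabilityTheory
open scoped ENNReal

noncomputable section

/-! ### Discrete-time Markov chains, given by the rows `P x` of a transition matrix -/

namespace MChain

variable {X : Type*}

/-- Every state can be reached from every state with positive probability. -/
def Irreducible (P : X → PMF X) : Prop :=
  ∀ x y : X, Relation.ReflTransGen (fun u v => P u v ≠ 0) x y

/-- `C` cannot be left. -/
def Closed (P : X → PMF X) (C : Set X) : Prop :=
  ∀ x ∈ C, ∀ y, P x y ≠ 0 → y ∈ C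

/-- The chain `P` with state space the closed set `C`: same transition probabilities. -/
def restrict (P : X → PMF X) (C : Set X) (hC : Closed P C) : C → PMF C := fun x =>
  ⟨fun y => P x y, by
    have h : ∑' y : C, P x y = 1 := by
      rw [← (P x).tsum_coe]
      refine tsum_subtype_eq_of_support_subset ?_
      intro y hy
      exact hC x x.2 y hy
    exact h ▸ ENNReal.summable.hasSum⟩

section law
variable [MeasurableSpace X] [DiscreteMeasurableSpace X]

/-- The transition matrix as a Markov kernel. -/
def stepKernel (P : X → PMF X) : Kernel X X :=
  ⟨fun x => (P x).toMeasure, Measurable.of_discrete⟩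

instance (P : X → PMF X) : IsMarkovKernel (stepKernel P) :=
  ⟨fun x => PMF.toMeasure.isProbabilityMeasure (P x)⟩

/-- The law on trajectories `X₀, X₁, X₂, …` of the Markov chain `P` started at `X₀ = x`. -/
def pathLaw (P : X → PMF X) (x : X) : Measure (ℕ → X) :=
  Kernel.traj (X := fun _ => X)
    (fun n => (stepKernel P).comap
      (fun past : (i : Finset.Iic n) → X => past ⟨n, Finset.mem_Iic.2 le_rfl⟩)
      (measurable_pi_apply _))
    0 (fun _ => x)

/-- The first passage time `τ_A = min {n ≥ 1 : X_n ∈ A}` (infinite if there is no such `n`). -/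
def passageTime (A : Set X) (path : ℕ → X) : ℕ∞ :=
  ⨅ n ∈ {n : ℕ | 1 ≤ n ∧ path n ∈ A}, (n : ℕ∞)

/-- `E_x [∑_{n = 0}^{τ_A - 1} c (X_n)]`. -/
def costToPassage (P : X → PMF X) (c : X → ℝ≥0∞) (A : Set X) (x : X) : ℝ≥0∞ :=
  ∫⁻ path, ∑' n : ℕ, {m : ℕ | (m : ℕ∞) < passageTime A path}.indicator
    (fun m => c (path m)) n ∂(pathLaw P x)

/-- `Y` is a `c`-regular set of states. -/
def CRegularSet (P : X → PMF X) (c : X → ℝ≥0∞) (Y : Set X) : Prop :=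
  ∀ A : Set X, A.Nonempty → ⨆ x ∈ Y, costToPassage P c A x < ∞

/-- The chain is `c`-regular: countably many `c`-regular sets cover the state space. -/
def CRegular (P : X → PMF X) (c : X → ℝ≥0∞) : Prop :=
  ∃ Y : ℕ → Set X, (∀ i, CRegularSet P c (Y i)) ∧ ⋃ i, Y i = Set.univ

/-- Positive recurrence: every state has a finite expected return time. -/
def PositiveRecurrent (P : X → PMF X) : Prop :=
  ∀ x : X, costToPassage P (fun _ => 1) {x} x < ∞

/-- Stability, for a chain with `size x` customers present in state `x`: the chain is positive
recurrent, it has a stationary distribution, and the stationary mean of `size` is finite. -/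
def Stable (P : X → PMF X) (size : X → ℕ) : Prop :=
  PositiveRecurrent P ∧
  (∃ μ : PMF X, μ.bind P = μ) ∧
  ∀ μ : PMF X, μ.bind P = μ → ∑' x, μ x * (size x : ℝ≥0∞) < ∞

end law

end MChain

/-! ### The multiclass discrete-time processor-sharing queue -/

/-- Schedules: `s j` messages of class `j` are served, at most `K` messages in total. -/
abbrev Schedule (J K : ℕ) : Type := {s : Fin J → ℕ // ∑ j, s j ≤ K}

instance (J K : ℕ) : Finite (Schedule J K) := by
  refine Finite.of_injective
    (fun (s : Schedule J K) (j : Fin J) => (⟨s.1 j, Nat.lt_succ_of_le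
      ((Finset.single_le_sum (fun _ _ => Nat.zero_le _) (Finset.mem_univ j)).trans s.2)⟩ :
        Fin (K + 1))) ?_
  intro s t h
  refine Subtype.ext (funext fun j => ?_)
  exact congrArg Fin.val (congrFun h j)

instance (J K : ℕ) : Fintype (Schedule J K) := Fintype.ofFinite _

instance (J K : ℕ) : Nonempty (Schedule J K) := ⟨⟨fun _ => 0, by simp⟩⟩

/-- A state vector: for each class `j` the list `x_j(1), …, x_j(n_j)` of the residual service
requirements of the class-`j` messages present, head of the queue first. -/
def State (J : ℕ) : Type := Fin J → List ℝ

instance (J : ℕ) : MeasurableSpace (State J) := ⊤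

instance (J : ℕ) : DiscreteMeasurableSpace (State J) := ⟨fun _ => trivial⟩

instance (J : ℕ) (C : Set (State J)) : DiscreteMeasurableSpace C :=
  ⟨fun s => ⟨Subtype.val '' s, trivial, Set.preimage_image_eq s Subtype.val_injective⟩⟩

namespace State

variable {J K : ℕ}

/-- The total number `n(α)` of messages in the system. -/
def size (α : State J) : ℕ := ∑ j, (α j).length

/-- The values a residual service requirement of class `j` can take: what is left, while positive,
of the requirement `S j` after service quanta of some schedules have been received. -/
def residuals (φ : Schedule J K → Fin J → ℝ) (S : Fin J → ℝ) (j : Fin J) : Set ℝ :=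
  {x | 0 < x ∧ ∃ l : List (Schedule J K), x = S j - (l.map fun s => φ s j).sum}

/-- All state vectors. -/
def vectors (φ : Schedule J K → Fin J → ℝ) (S : Fin J → ℝ) : Set (State J) :=
  {α | ∀ j, ∀ x ∈ α j, x ∈ residuals φ S j}

open Classical in
/-- One time-slot: under schedule `s` the first `s j` messages of queue `j` each receive the
service quantum `φ s j`, those whose requirement is met leave, and then `a j` new messages,
each with requirement `S j`, join the queue. -/
def next (φ : Schedule J K → Fin J → ℝ) (S : Fin J → ℝ) (α : State J) (s : Schedule J K)
    (a : Fin J → ℕ) : State J := fun j =>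
  (((α j).take (s.1 j)).map fun x => x - φ s j).filter (fun x => 0 < x)
    ++ (α j).drop (s.1 j) ++ List.replicate (a j) (S j)

/-- The maximal sub-schedule of `s` in state `α`. -/
def maxSub (s : Schedule J K) (α : State J) : Schedule J K :=
  ⟨fun j => min (s.1 j) (α j).length,
    (Finset.sum_le_sum fun _ _ => min_le_left _ _).trans s.2⟩

end State

/-- The joint law of the independent batch sizes `A_1, …, A_J` of one time-slot. -/
def arrivalLaw {J : ℕ} (arr : Fin J → PMF ℕ) : PMF (Fin J → ℕ) :=
  (Measure.pi fun j => (arr j).toMeasure).toPMF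

/-- The mean `E A` of a batch size with law `q`. -/
def batchMean (q : PMF ℕ) : ℝ := ∑' k : ℕ, (q k).toReal * (k : ℝ)

/-- The state-independent policy with schedule distribution `pω`: the law of the schedule
implemented in state `α` is the law of the maximal sub-schedule of a `pω`-random schedule. -/
def stateIndependentPolicy {J K : ℕ} (pω : PMF (Schedule J K)) (α : State J) :
    PMF (Schedule J K) :=
  pω.map fun s => State.maxSub s α

/-- Transition probabilities of the queue under a stationary randomized policy. -/
def queueChain {J K : ℕ} (φ : Schedule J K → Fin J → ℝ) (S : Fin J → ℝ) (arr : Fin J → PMF ℕ)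
    (policy : State J → PMF (Schedule J K)) : State J → PMF (State J) := fun α =>
  (policy α).bind fun s => (arrivalLaw arr).map fun a => State.next φ S α s a

/-- `φ̄_j`, the maximum of `φ_j(s)` over all schedules `s`. -/
def maxQuantum {J K : ℕ} (φ : Schedule J K → Fin J → ℝ) (j : Fin J) : ℝ :=
  Finset.univ.sup' Finset.univ_nonempty fun s => φ s j

/-- The function `c(α) = 1 + ∑_j ∑_k (x_j(k) + φ̄_j)`. -/
def costFun {J K : ℕ} (φ : Schedule J K → Fin J → ℝ) (α : State J) : ℝ :=
  1 + ∑ j, ((α j).map fun x => x + maxQuantum φ j).sum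

/-! ### Independent decoding over a multiaccess channel -/

/-- The class-`j` service requirement `S_j = -ln p_{e,j} + ρ ln M_j`. -/
def serviceRequirement {J : ℕ} (ρ : ℝ) (M : Fin J → ℕ) (pe : Fin J → ℝ) (j : Fin J) : ℝ :=
  -Real.log (pe j) + ρ * Real.log (M j)

/-- The index set of the channel inputs under the schedule `s`: one for each scheduled message. -/
abbrev Inputs {J K : ℕ} (s : Schedule J K) : Type := (j : Fin J) × Fin (s.1 j)

/-- A discrete memoryless multiaccess channel: finite input alphabets, a finite output alphabet, a
transition law `p s x y` from the vector input `x` for each schedule `s`, and the random-coding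
probability assignments `Q j` on the input alphabets. -/
structure DiscreteMAC (J K : ℕ) where
  Input : Fin J → Type
  Output : Type
  [inputFintype : ∀ j, Fintype (Input j)]
  [outputFintype : Fintype Output]
  p : (s : Schedule J K) → ((i : Inputs s) → Input i.1) → Output → ℝ
  p_nonneg : ∀ s x y, 0 ≤ p s x y
  p_sum : ∀ s x, ∑ y, p s x y = 1
  Q : (j : Fin J) → Input j → ℝ
  Q_nonneg : ∀ j x, 0 ≤ Q j x
  Q_sum : ∀ j, ∑ x, Q j x = 1

attribute [instance] DiscreteMAC.inputFintype DiscreteMAC.outputFintype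

namespace DiscreteMAC

variable {J K : ℕ} (ch : DiscreteMAC J K)

open Classical in
/-- The effective channel `p_j^s(y | x_j)` seen by the first class-`j` message when all the other
scheduled messages are averaged over their random codes. -/
def effective (s : Schedule J K) (j : Fin J) (h : 0 < s.1 j) (xj : ch.Input j)
    (y : ch.Output) : ℝ :=
  ∑ x : (i : Inputs s) → ch.Input i.1,
    if x ⟨j, ⟨0, h⟩⟩ = xj then
      ch.p s x y * ∏ i ∈ Finset.univ.erase (⟨j, ⟨0, h⟩⟩ : Inputs s), ch.Q i.1 (x i)
    else 0

/-- The random-coding exponent `E_{o,j}^s(ρ, Q_j)` of the effective channel. -/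
def exponent (ρ : ℝ) (s : Schedule J K) (j : Fin J) (h : 0 < s.1 j) : ℝ :=
  -Real.log (∑ y, (∑ xj, ch.Q j xj * ch.effective s j h xj y ^ (1 / (1 + ρ))) ^ (1 + ρ))

/-- The available service quantum `φ_j(s)`. -/
def quantum (ρ : ℝ) (s : Schedule J K) (j : Fin J) : ℝ :=
  if h : 0 < s.1 j then ch.exponent ρ s j h else 0

end DiscreteMAC

/-- Gaussian encoding over an additive white Gaussian noise multiaccess channel: transmit power,
noise density `N₀`, bandwidth `W`, and the multiplicative gain of each class. -/
structure GaussianMAC (J : ℕ) where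
  power : ℝ
  power_pos : 0 < power
  N₀ : ℝ
  N₀_pos : 0 < N₀
  W : ℝ
  W_pos : 0 < W
  gain : Fin J → ℂ
  gain_ne_zero : ∀ j, gain j ≠ 0

namespace GaussianMAC

variable {J K : ℕ} (ch : GaussianMAC J)

/-- The received power `P_j = |γ_j|² P`. -/
def received (j : Fin J) : ℝ := ‖ch.gain j‖ ^ 2 * ch.power

/-- The available service quantum `φ_j(s)`: the random-coding exponent for Gaussian encoding. -/
def quantum (ρ : ℝ) (s : Schedule J K) (j : Fin J) : ℝ :=
  if 0 < s.1 j then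
    ρ * Real.log (1 + ch.received j /
      ((1 + ρ) * ((∑ k, (s.1 k : ℝ) * ch.received k) - ch.received j + ch.N₀ * ch.W)))
  else 0

end GaussianMAC

/-- The channels considered for independent decoding. -/
inductive Channel (J K : ℕ) where
  | discrete (ch : DiscreteMAC J K)
  | gaussian (ch : GaussianMAC J)

namespace Channel

/-- The available service quantum `φ_j(s)`. -/
def quantum {J K : ℕ} (ch : Channel J K) (ρ : ℝ) : Schedule J K → Fin J → ℝ :=
  match ch with
  | discrete c => c.quantum ρ
  | gaussian c => c.quantum ρ

end Channel

end

noncomputable section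

/-! The proof is a Foster–Lyapunov argument. Give queue `j` the weight `w_j`, the sum of `x + φ̄_j`
over its messages, and take `V = ∑ w_j²`. An arrival adds `S_j + φ̄_j` to `w_j`. Let `t` be the
implemented schedule. A served message that stays loses `φ_j(t)`; one that leaves takes away its
residual plus `φ̄_j`, hence at least `φ_j(t)`. The extra `φ̄_j` thus pays for the wasted part of the
last quantum (`State.weight_served_le`). If queue `j` holds at least `s_j` messages, then `t_j =
s_j` with no more interferers, so service lowers `w_j` by at least `s_j φ_j(s)`; otherwise `w_j` is
below a constant. In both cases `w_j²` grows by at most `2 w_j ((S_j + φ̄_j) A_j - s_j φ_j(s))` plus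
a term of bounded mean (`IsQuantum.sq_weight_next_le`). After averaging, the stability condition
gives `V` a drift of at most `-2ε ∑ w_j` plus a constant. Residuals take finitely many values, so
sublevel sets of `c = 1 + ∑ w_j` are finite; half of the drift absorbs the constant outside such a
set, and `V/ε` has drift at most `-c` there.

For general chains, let `T` be the one-step operator killed on entering `A`. The expected cost up to
the passage to `A` is `∑ Tⁿ c`, and every `W` with `T W + c ≤ W` dominates it. Irreducibility
yields, for a finite set `F`, a bounded `U` with `T U + 1_F ≤ U`, so the Lyapunov function plus `b
U` is such a `W`. The resulting bound is uniform on sublevel sets of the Lyapunov function, which is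
`c`-regularity; `c ≥ 1` gives positive recurrence. Occupation measures of excursions yield a
stationary distribution, and truncation bounds the stationary mean of `c`, which dominates `n(α)` up
to a factor. -/

theorem PMF.toMeasure_eq_sum_dirac {X : Type*} [MeasurableSpace X] (p : PMF X) :
    p.toMeasure = Measure.sum fun x => p x • Measure.dirac x := by
  ext s hs
  rw [p.toMeasure_apply hs, Measure.sum_apply _ hs]
  refine tsum_congr fun x => ?_
  by_cases hx : x ∈ s <;> simp [hs, hx]

theorem PMF.lintegral_eq_tsum_mul {X : Type*} [MeasurableSpace X] [DiscreteMeasurableSpace X]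
    (p : PMF X) (f : X → ℝ≥0∞) : ∫⁻ x, f x ∂p.toMeasure = ∑' x, p x * f x := by
  rw [PMF.toMeasure_eq_sum_dirac, lintegral_sum_measure]
  refine tsum_congr fun x => ?_
  rw [lintegral_smul_measure, lintegral_dirac' _ (Measurable.of_discrete), smul_eq_mul]

/-! ### The taboo operator and the law of trajectories -/

namespace MChain

variable {X : Type*}

/-- The expectation of `f` after one step, as a function of the initial state. -/
def step (P : X → PMF X) (f : X → ℝ≥0∞) (x : X) : ℝ≥0∞ := ∑' y, P x y * f y

/-- The expectation of `f` after one step on the event that the step does not enter `A`. -/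
def tabooStep (P : X → PMF X) (A : Set X) (f : X → ℝ≥0∞) : X → ℝ≥0∞ :=
  step P (Aᶜ.indicator f)

open Classical in
/-- `f` at time `n`, on the event that `A` is avoided from time `1` to time `n`. -/
def avoiding (A : Set X) (f : X → ℝ≥0∞) (n : ℕ) (path : ℕ → X) : ℝ≥0∞ :=
  if ∀ i, 1 ≤ i → i ≤ n → path i ∉ A then f (path n) else 0

theorem avoiding_succ (A : Set X) (f : X → ℝ≥0∞) (n : ℕ) (path : ℕ → X) :
    avoiding A f (n + 1) path = avoiding A (fun _ => Aᶜ.indicator f (path (n + 1))) n path := by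
  classical
  unfold avoiding
  by_cases h : ∀ i, 1 ≤ i → i ≤ n → path i ∉ A
  · rw [if_pos h]
    by_cases h' : path (n + 1) ∈ A
    · rw [if_neg fun H => H (n + 1) (by omega) le_rfl h']
      simp [h']
    · rw [if_pos, Set.indicator_of_mem h']
      intro i h1 h2
      rcases Nat.le_succ_iff.1 h2 with h2 | rfl
      · exact h i h1 h2
      · exact h'
  · rw [if_neg h, if_neg fun H => h fun i h1 h2 => H i h1 (by omega)]

theorem lt_passageTime_iff (A : Set X) (path : ℕ → X) (n : ℕ) :
    (n : ℕ∞) < passageTime A path ↔ ∀ i, 1 ≤ i → i ≤ n → path i ∉ A := by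
  unfold passageTime
  rw [← ENat.add_one_le_iff (ENat.natCast_ne_top n), le_iInf₂_iff]
  constructor
  · intro h i h1 h2 hA
    have := h i ⟨h1, hA⟩
    norm_cast at this
    omega
  · rintro h i ⟨h1, hA⟩
    norm_cast
    by_contra hc
    exact h i h1 (by omega) hA

section law
variable [MeasurableSpace X] [DiscreteMeasurableSpace X]

/-- The transition kernels, from finite pasts, whose trajectory law is `pathLaw`. -/
def pastKernel (P : X → PMF X) (n : ℕ) : Kernel ((i : Finset.Iic n) → X) X :=
  (stepKernel P).comap (fun past => past ⟨n, Finset.mem_Iic.2 le_rfl⟩) (measurable_pi_apply _)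

instance (P : X → PMF X) (n : ℕ) : IsMarkovKernel (pastKernel P n) := by
  unfold pastKernel; infer_instance

theorem pathLaw_eq (P : X → PMF X) (x : X) :
    pathLaw P x = Kernel.traj (X := fun _ => X) (pastKernel P) 0 (fun _ => x) := rfl

theorem measurable_avoiding (A : Set X) (f : X → ℝ≥0∞) (n : ℕ) :
    Measurable (avoiding A f n) := by
  classical
  unfold avoiding
  refine Measurable.ite ?_ ((Measurable.of_discrete (f := f)).comp (measurable_pi_apply n))
    measurable_const
  have : {path : ℕ → X | ∀ i, 1 ≤ i → i ≤ n → path i ∉ A} =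
      ⋂ i, ⋂ (_ : 1 ≤ i), ⋂ (_ : i ≤ n), (fun path : ℕ → X => path i) ⁻¹' Aᶜ := by
    ext; simp
  rw [this]
  exact MeasurableSet.iInter fun i => MeasurableSet.iInter fun _ => MeasurableSet.iInter fun _ =>
    measurable_pi_apply i (MeasurableSet.of_discrete)

/-- Conditioning on the first `n` steps: the form in which the Markov property is used. -/
theorem lintegral_pathLaw (P : X → PMF X) (x : X) (n : ℕ) {f : (ℕ → X) → ℝ≥0∞}
    (hf : Measurable f) :
    ∫⁻ path, f path ∂pathLaw P x =
      ∫⁻ u, ∫⁻ path, f (Function.updateFinset path (Finset.Iic n) u)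
        ∂Kernel.traj (X := fun _ => X) (pastKernel P) n u
        ∂Kernel.partialTraj (X := fun _ => X) (pastKernel P) 0 n (fun _ => x) := by
  rw [pathLaw_eq, ← Kernel.traj_comp_partialTraj (Nat.zero_le n), Kernel.lintegral_comp _ _ _ hf]
  refine lintegral_congr fun u => ?_
  rw [Kernel.lintegral_traj _ hf]

/-- Markov property at time `n`: avoidance up to `n` is fixed by the past, and the mean over the
last step turns `f` into `tabooStep P A f`. -/
theorem lintegral_avoiding_succ (P : X → PMF X) (A : Set X) (f : X → ℝ≥0∞) (n : ℕ) (x : X) :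
    ∫⁻ path, avoiding A f (n + 1) path ∂pathLaw P x =
      ∫⁻ path, avoiding A (tabooStep P A f) n path ∂pathLaw P x := by
  classical
  rw [lintegral_pathLaw P x n (measurable_avoiding _ _ _),
    lintegral_pathLaw P x n (measurable_avoiding _ _ _)]
  refine lintegral_congr fun u => ?_
  have hu : ∀ (path : ℕ → X) (i : ℕ) (hi : i ≤ n),
      Function.updateFinset path (Finset.Iic n) u i = u ⟨i, Finset.mem_Iic.2 hi⟩ := by
    intro path i hi
    simp [Function.updateFinset, hi]
  have hs : ∀ path : ℕ → X, Function.updateFinset path (Finset.Iic n) u (n + 1) = path (n + 1) := by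
    intro path
    simp [Function.updateFinset]
  have key : ∀ (g : X → ℝ≥0∞) (path : ℕ → X),
      avoiding A g n (Function.updateFinset path (Finset.Iic n) u) =
        if ∀ i, 1 ≤ i → ∀ hi : i ≤ n, u ⟨i, Finset.mem_Iic.2 hi⟩ ∉ A then
          g (u ⟨n, Finset.mem_Iic.2 le_rfl⟩) else 0 := by
    intro g path
    unfold avoiding
    rw [hu path n le_rfl]
    congr 1
    refine propext (forall_congr' fun i => forall_congr' fun h1 => forall_congr' fun hi => ?_)
    rw [hu path i hi]
  simp only [avoiding_succ, key, hs]
  by_cases h : ∀ i, 1 ≤ i → ∀ hi : i ≤ n, u ⟨i, Finset.mem_Iic.2 hi⟩ ∉ A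
  · simp only [if_pos h]
    -- On the right the integrand depends on the past alone; on the left only the law of the
    -- coordinate `n + 1` matters, and it is the row of `P` at the current state.
    rw [lintegral_const, measure_univ, mul_one]
    have hm : Measurable fun path : ℕ → X => path (n + 1) := measurable_pi_apply _
    rw [← lintegral_map (μ := Kernel.traj (X := fun _ => X) (pastKernel P) n u)
      (f := Aᶜ.indicator f) Measurable.of_discrete hm,
      ← Kernel.map_apply _ hm, Kernel.map_traj_succ_self]
    exact PMF.lintegral_eq_tsum_mul _ _
  · simp only [if_neg h, lintegral_zero]

theorem lintegral_avoiding (P : X → PMF X) (A : Set X) (n : ℕ) (f : X → ℝ≥0∞) (x : X) :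
    ∫⁻ path, avoiding A f n path ∂pathLaw P x = (tabooStep P A)^[n] f x := by
  induction n generalizing f with
  | zero =>
    classical
    have h0 : ∀ path, avoiding A f 0 path = f (path 0) := by
      intro path
      unfold avoiding
      exact if_pos fun i h1 h2 => by omega
    rw [lintegral_pathLaw P x 0 (measurable_avoiding _ _ _), Kernel.partialTraj_self]
    simp only [h0, Function.iterate_zero, id]
    have : ∀ (u : (i : Finset.Iic 0) → X) (path : ℕ → X),
        Function.updateFinset path (Finset.Iic 0) u 0 = u ⟨0, by simp⟩ := by
      intro u path
      simp [Function.updateFinset]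
    simp only [this, lintegral_const, measure_univ, mul_one, Kernel.id_apply]
    rw [lintegral_dirac']
    exact (Measurable.of_discrete (f := f)).comp (measurable_pi_apply _)
  | succ n ih => rw [lintegral_avoiding_succ, ih, Function.iterate_succ_apply]

/-- The cost up to the first passage is the potential of the taboo step. -/
theorem costToPassage_eq_tsum (P : X → PMF X) (c : X → ℝ≥0∞) (A : Set X) (x : X) :
    costToPassage P c A x = ∑' n, (tabooStep P A)^[n] c x := by
  classical
  unfold costToPassage
  have : ∀ (path : ℕ → X) (n : ℕ),
      {m : ℕ | (m : ℕ∞) < passageTime A path}.indicator (fun m => c (path m)) n =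
        avoiding A c n path := by
    intro path n
    simp only [Set.indicator, Set.mem_ofPred_eq, lt_passageTime_iff, avoiding]
    congr
  simp only [this]
  rw [lintegral_tsum fun n => (measurable_avoiding A c n).aemeasurable]
  exact tsum_congr fun n => lintegral_avoiding P A n c x

end law

/-! ### Potential theory of the taboo operator -/

theorem step_mono (P : X → PMF X) {f g : X → ℝ≥0∞} (h : f ≤ g) : step P f ≤ step P g :=
  fun _ => ENNReal.tsum_le_tsum fun y => mul_le_mul_right (h y) _

theorem step_add (P : X → PMF X) (f g : X → ℝ≥0∞) : step P (f + g) = step P f + step P g := by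
  funext x
  simp only [step, Pi.add_apply, mul_add]
  exact ENNReal.tsum_add

theorem step_const_mul (P : X → PMF X) (a : ℝ≥0∞) (f : X → ℝ≥0∞) :
    step P (fun x => a * f x) = fun x => a * step P f x := by
  funext x
  simp only [step]
  rw [← ENNReal.tsum_mul_left]
  exact tsum_congr fun y => by ring

theorem step_one (P : X → PMF X) (x : X) : step P 1 x = 1 := by
  simp [step, (P x).tsum_coe]

theorem tabooStep_mono (P : X → PMF X) (A : Set X) : Monotone (tabooStep P A) :=
  fun _ _ h => step_mono P (Set.indicator_mono h)

theorem tabooStep_le_step (P : X → PMF X) (A : Set X) (f : X → ℝ≥0∞) :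
    tabooStep P A f ≤ step P f :=
  step_mono P (Set.indicator_le_self _ _)

theorem tabooStep_add (P : X → PMF X) (A : Set X) (f g : X → ℝ≥0∞) :
    tabooStep P A (f + g) = tabooStep P A f + tabooStep P A g := by
  unfold tabooStep
  rw [← step_add]
  congr 1
  exact Set.indicator_add' _ f g

theorem iterate_tabooStep_add (P : X → PMF X) (A : Set X) (n : ℕ) (f g : X → ℝ≥0∞) :
    (tabooStep P A)^[n] (f + g) = (tabooStep P A)^[n] f + (tabooStep P A)^[n] g := by
  induction n generalizing f g with
  | zero => rfl
  | succ n ih => simp only [Function.iterate_succ_apply, tabooStep_add, ih]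

theorem tabooStep_const_mul (P : X → PMF X) (A : Set X) (a : ℝ≥0∞) (f : X → ℝ≥0∞) :
    tabooStep P A (fun x => a * f x) = fun x => a * tabooStep P A f x := by
  unfold tabooStep
  rw [← step_const_mul]
  congr 1
  funext x
  by_cases h : x ∈ A <;> simp [h]

theorem tabooStep_sum (P : X → PMF X) (A : Set X) (f : ℕ → X → ℝ≥0∞) (m : ℕ) :
    tabooStep P A (∑ k ∈ Finset.range m, f k) = ∑ k ∈ Finset.range m, tabooStep P A (f k) := by
  induction m with
  | zero => funext x; simp [tabooStep, step]
  | succ m ih => rw [Finset.sum_range_succ, Finset.sum_range_succ, tabooStep_add, ih]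

/-- A supersolution of the taboo Poisson equation dominates the potential. -/
theorem tsum_iterate_tabooStep_le (P : X → PMF X) (A : Set X) {c W : X → ℝ≥0∞}
    (h : tabooStep P A W + c ≤ W) (x : X) : ∑' n, (tabooStep P A)^[n] c x ≤ W x := by
  -- Telescoping: iterating the inequality `N` times leaves a nonnegative remainder, which is
  -- dropped at the end.
  have key : ∀ N, (tabooStep P A)^[N] W + ∑ n ∈ Finset.range N, (tabooStep P A)^[n] c ≤ W := by
    intro N
    induction N with
    | zero => simp
    | succ N ih =>
      refine le_trans ?_ ih
      rw [Finset.sum_range_succ, Function.iterate_succ_apply]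
      have h2 : (tabooStep P A)^[N] (tabooStep P A W) + (tabooStep P A)^[N] c ≤
          (tabooStep P A)^[N] W := by
        rw [← iterate_tabooStep_add]
        exact (tabooStep_mono P A).iterate N h
      calc _ = ((tabooStep P A)^[N] (tabooStep P A W) + (tabooStep P A)^[N] c) +
            ∑ n ∈ Finset.range N, (tabooStep P A)^[n] c := by ring
        _ ≤ _ := by gcongr
  refine ENNReal.tsum_le_of_sum_range_le fun N => ?_
  have := key N x
  simp only [Pi.add_apply, Finset.sum_apply] at this
  exact le_trans le_add_self this

theorem iterate_tabooStep_one_le (P : X → PMF X) (A : Set X) (n : ℕ) :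
    (tabooStep P A)^[n] 1 ≤ 1 := by
  induction n with
  | zero => exact le_rfl
  | succ n ih =>
    rw [Function.iterate_succ_apply']
    intro x
    exact ((tabooStep_mono P A ih).trans (tabooStep_le_step P A 1) x).trans_eq (step_one P x)

theorem antitone_iterate_tabooStep_one (P : X → PMF X) (A : Set X) :
    Antitone fun n => (tabooStep P A)^[n] (1 : X → ℝ≥0∞) := by
  refine antitone_nat_of_succ_le fun n => ?_
  rw [Function.iterate_succ_apply]
  exact (tabooStep_mono P A).iterate n (iterate_tabooStep_one_le P A 1)

/-- One transition of positive probability along which mass is lost makes the whole average strictly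
smaller than `1`. -/
theorem tabooStep_lt_one (P : X → PMF X) (A : Set X) {f : X → ℝ≥0∞} (hf : f ≤ 1) {x y : X}
    (hxy : P x y ≠ 0) (h : y ∈ A ∨ f y < 1) : tabooStep P A f x < 1 := by
  have hle : ∀ z, P x z * Aᶜ.indicator f z ≤ P x z := fun z =>
    mul_le_of_le_one_right' ((Set.indicator_le_self _ _ z).trans (hf z))
  have hfin : ∑' z, P x z * Aᶜ.indicator f z ≠ ∞ :=
    ne_top_of_le_ne_top (by rw [(P x).tsum_coe]; simp) (ENNReal.tsum_le_tsum hle)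
  have hlt : Aᶜ.indicator f y < 1 := by
    rcases h with h | h
    · simp [h]
    · exact (Set.indicator_le_self _ _ y).trans_lt h
  calc tabooStep P A f x < ∑' z, P x z := by
        refine ENNReal.tsum_lt_tsum hfin hle (i := y) ?_
        calc _ < P x y * 1 := (ENNReal.mul_lt_mul_iff_right hxy ((P x).apply_ne_top y)).2 hlt
          _ = _ := mul_one _
    _ = 1 := (P x).tsum_coe

theorem exists_iterate_tabooStep_lt_one (P : X → PMF X) {x y : X} {A : Set X} (hy : y ∈ A)
    (h : Relation.TransGen (fun u v => P u v ≠ 0) x y) :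
    ∃ m, (tabooStep P A)^[m] 1 x < 1 := by
  induction h using Relation.TransGen.head_induction_on with
  | single h => exact ⟨1, tabooStep_lt_one P A le_rfl h (Or.inl hy)⟩
  | head h _ ih =>
    obtain ⟨m, hm⟩ := ih
    refine ⟨m + 1, ?_⟩
    rw [Function.iterate_succ_apply']
    exact tabooStep_lt_one P A (iterate_tabooStep_one_le P A m) h (Or.inr hm)

theorem Irreducible.transGen {P : X → PMF X} (h : Irreducible P) (x y : X) :
    Relation.TransGen (fun u v => P u v ≠ 0) x y := by
  obtain ⟨w, hw⟩ := (P x).support_nonempty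
  exact Relation.TransGen.head' ((P x).mem_support_iff w |>.1 hw) (h w y)

/-- The expected number of visits to a finite set before hitting `A` is bounded. -/
theorem exists_bounded_tabooStep_add_indicator_le {P : X → PMF X} (hirr : Irreducible P)
    {F : Set X} (hF : F.Finite) {A : Set X} (hA : A.Nonempty) :
    ∃ (U : X → ℝ≥0∞) (B : ℝ≥0∞), B ≠ ∞ ∧ (∀ x, U x ≤ B) ∧
      tabooStep P A U + F.indicator 1 ≤ U := by
  obtain ⟨y, hy⟩ := hA
  choose m hm using fun x => exists_iterate_tabooStep_lt_one P hy (hirr.transGen x y)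
  -- Survival probabilities decrease in time, so one horizon `N` serves all of the finite set `F`.
  obtain ⟨N, hN⟩ : ∃ N, ∀ x ∈ F, m x ≤ N := by
    obtain ⟨N, hN⟩ := (hF.image m).bddAbove
    exact ⟨N, fun x hx => hN ⟨x, hx, rfl⟩⟩
  set q : ℕ → X → ℝ≥0∞ := fun k => (tabooStep P A)^[k] 1 with hq
  have hqN : ∀ x ∈ F, q N x < 1 := fun x hx =>
    (antitone_iterate_tabooStep_one P A (hN x hx) x).trans_lt (hm x)
  -- `δ` is the least probability over `F` of hitting `A` within `N` steps; the cap at `1` keeps it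
  -- finite when `F` is empty.
  obtain ⟨δ, hδ0, hδ1, hδ⟩ : ∃ δ : ℝ≥0∞, δ ≠ 0 ∧ δ ≤ 1 ∧ ∀ x ∈ F, q N x + δ ≤ 1 := by
    refine ⟨hF.toFinset.inf (fun x => 1 - q N x) ⊓ 1, ?_, inf_le_right, fun x hx => ?_⟩
    · refine ne_of_gt (lt_inf_iff.2 ⟨?_, one_pos⟩)
      rw [Finset.lt_inf_iff (by simp)]
      exact fun x hx => tsub_pos_of_lt (hqN x (hF.mem_toFinset.1 hx))
    · have : hF.toFinset.inf (fun x => 1 - q N x) ⊓ 1 ≤ 1 - q N x :=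
        inf_le_left.trans (Finset.inf_le (hF.mem_toFinset.2 hx))
      calc _ ≤ q N x + (1 - q N x) := by gcongr
        _ = 1 := add_tsub_cancel_of_le (hqN x hx).le
  -- `g` is the mean of `min τ_A N`. It loses `1 - q N` under a taboo step, hence at least `δ` on
  -- `F`, so `U = g / δ` works.
  set g : X → ℝ≥0∞ := ∑ k ∈ Finset.range N, q k with hg
  have hgN : ∀ x, g x ≤ N := by
    intro x
    rw [hg, Finset.sum_apply]
    calc _ ≤ ∑ k ∈ Finset.range N, (1 : ℝ≥0∞) :=
          Finset.sum_le_sum fun k _ => iterate_tabooStep_one_le P A k x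
      _ = N := by simp
  have hgeq : tabooStep P A g + 1 = g + q N := by
    have : tabooStep P A g = ∑ k ∈ Finset.range N, q (k + 1) := by
      rw [hg, tabooStep_sum]
      exact Finset.sum_congr rfl fun k _ => (Function.iterate_succ_apply' _ _ _).symm
    rw [this, hg, ← Finset.sum_range_succ, Finset.sum_range_succ']
    rfl
  have hδt : δ ≠ ∞ := ne_top_of_le_ne_top ENNReal.one_ne_top hδ1
  have hle : ∀ x, tabooStep P A g x + δ * F.indicator 1 x ≤ g x := by
    intro x
    have hqt : q N x ≠ ∞ :=
      ne_top_of_le_ne_top ENNReal.one_ne_top (iterate_tabooStep_one_le P A N x)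
    refine (ENNReal.add_le_add_iff_right hqt).1 ?_
    have h1 : q N x + δ * F.indicator 1 x ≤ 1 := by
      by_cases hx : x ∈ F
      · simpa [hx] using hδ x hx
      · simpa [hx] using iterate_tabooStep_one_le P A N x
    calc _ = tabooStep P A g x + (q N x + δ * F.indicator 1 x) := by ring
      _ ≤ tabooStep P A g x + 1 := by gcongr
      _ = g x + q N x := congrFun hgeq x
  refine ⟨fun x => δ⁻¹ * g x, δ⁻¹ * N, ENNReal.mul_ne_top (ENNReal.inv_ne_top.2 hδ0) (by simp),
    fun x => mul_le_mul_right (hgN x) _, ?_⟩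
  rw [tabooStep_const_mul]
  intro x
  calc _ = δ⁻¹ * (tabooStep P A g x + δ * F.indicator 1 x) := by
        rw [mul_add, ← mul_assoc, ENNReal.inv_mul_cancel hδ0 hδt, one_mul]; rfl
    _ ≤ _ := mul_le_mul_right (hle x) _

/-- Under a Foster-Lyapunov drift condition towards a finite set, the potential of the cost before
hitting `A` is bounded by the Lyapunov function plus a constant. -/
theorem exists_tsum_iterate_tabooStep_le {P : X → PMF X} (hirr : Irreducible P)
    {V c : X → ℝ≥0∞} {b : ℝ≥0∞} (hb : b ≠ ∞) {F : Set X} (hF : F.Finite)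
    (hdrift : ∀ x, step P V x + c x ≤ V x + b * F.indicator 1 x) {A : Set X} (hA : A.Nonempty) :
    ∃ B : ℝ≥0∞, B ≠ ∞ ∧ ∀ x, ∑' n, (tabooStep P A)^[n] c x ≤ V x + B := by
  obtain ⟨U, B, hB, hUB, hU⟩ := exists_bounded_tabooStep_add_indicator_le hirr hF hA
  refine ⟨b * B, ENNReal.mul_ne_top hb hB, fun x => ?_⟩
  -- The decrease of `b * U` on `F` cancels the excess `b` allowed there by the drift condition.
  refine (tsum_iterate_tabooStep_le P A (W := V + fun x => b * U x) ?_ x).trans ?_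
  · rw [tabooStep_add, tabooStep_const_mul]
    intro x
    have ht : b * F.indicator 1 x ≠ ∞ := by
      by_cases hx : x ∈ F <;> simp [hx, hb]
    refine (ENNReal.add_le_add_iff_right ht).1 ?_
    have h1 := hU x
    simp only [Pi.add_apply] at h1 ⊢
    calc _ = (tabooStep P A V x + c x) + b * (tabooStep P A U x + F.indicator 1 x) := by ring
      _ ≤ (V x + b * F.indicator 1 x) + b * U x := by
        exact add_le_add ((add_le_add_left (tabooStep_le_step P A V x) _).trans (hdrift x))
          (mul_le_mul_right h1 _)
      _ = _ := by ring
  · simp only [Pi.add_apply]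
    gcongr
    exact hUB x

/-! ### Stationary distributions -/

/-- The law at time `n`, started at `x`, on the event that `x` is not revisited up to time `n`. -/
def excursion (P : X → PMF X) (x : X) : ℕ → X → ℝ≥0∞
  | 0 => ({x} : Set X).indicator 1
  | n + 1 => ({x}ᶜ : Set X).indicator fun z => ∑' y, excursion P x n y * P y z

/-- Duality: `excursion` moves measures forward by the operator that `tabooStep P {x}` applies to
functions. -/
theorem tsum_excursion_mul (P : X → PMF X) (x : X) (n : ℕ) (f : X → ℝ≥0∞) :
    ∑' y, excursion P x n y * f y = (tabooStep P {x})^[n] f x := by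
  induction n generalizing f with
  | zero =>
    rw [tsum_eq_single x]
    · simp [excursion]
    · intro y hy
      simp [excursion, hy]
  | succ n ih =>
    rw [Function.iterate_succ_apply, ← ih]
    have : ∀ z, excursion P x (n + 1) z * f z =
        ∑' y, excursion P x n y * (P y z * ({x}ᶜ : Set X).indicator f z) := by
      intro z
      by_cases hz : z = x
      · simp [excursion, hz]
      · simp only [excursion, Set.mem_compl_iff, Set.mem_singleton_iff, hz, not_false_eq_true,
          Set.indicator_of_mem]
        rw [← ENNReal.tsum_mul_right]
        exact tsum_congr fun y => mul_assoc _ _ _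
    simp only [this]
    rw [ENNReal.tsum_comm]
    exact tsum_congr fun y => ENNReal.tsum_mul_left

/-- If the expected return time to `x` is finite, there is a stationary distribution. -/
theorem exists_stationary {P : X → PMF X} {x : X}
    (h : ∑' n, (tabooStep P {x})^[n] 1 x ≠ ∞) : ∃ μ : PMF X, μ.bind P = μ := by
  obtain ⟨ν, hν⟩ : ∃ ν : X → ℝ≥0∞, ν = fun y => ∑' n, excursion P x n y := ⟨_, rfl⟩
  have hmass : ∑' y, ν y = ∑' n, (tabooStep P {x})^[n] 1 x := by
    rw [hν, ENNReal.tsum_comm]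
    refine tsum_congr fun n => ?_
    rw [← tsum_excursion_mul]
    simp
  have htop : ∑' y, ν y ≠ ∞ := hmass ▸ h
  have hone : 1 ≤ ν x := by
    rw [hν]
    refine le_trans ?_ (ENNReal.le_tsum 0)
    simp [excursion]
  have hzero : ∑' y, ν y ≠ 0 := by
    intro h0
    have := hone.trans (ENNReal.le_tsum x)
    rw [h0] at this
    simp at this
  have hmul : ∀ z, ∑' y, ν y * P y z = ∑' n, ∑' y, excursion P x n y * P y z := by
    intro z
    rw [ENNReal.tsum_comm, hν]
    exact tsum_congr fun y => ENNReal.tsum_mul_right.symm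
  have hne : ∀ z, z ≠ x → ∑' y, ν y * P y z = ν z := by
    intro z hz
    rw [hmul, hν]
    simp only
    rw [tsum_eq_zero_add' (f := fun n => excursion P x n z) ENNReal.summable]
    simp [excursion, hz]
  -- Instead of computing the return probability: a step preserves the finite total mass, and the
  -- masses agree off `x`, so they agree at `x`.
  have hx : ∑' y, ν y * P y x = ν x := by
    have htot : ∑' z, ∑' y, ν y * P y z = ∑' z, ν z := by
      rw [ENNReal.tsum_comm]
      refine tsum_congr fun y => ?_
      rw [ENNReal.tsum_mul_left, (P y).tsum_coe, mul_one]
    classical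
    rw [ENNReal.tsum_eq_add_tsum_ite (f := fun z => ∑' y, ν y * P y z) x,
      ENNReal.tsum_eq_add_tsum_ite (f := ν) x] at htot
    have he : ∑' z, (if z = x then 0 else ∑' y, ν y * P y z) = ∑' z, if z = x then 0 else ν z := by
      refine tsum_congr fun z => ?_
      split_ifs with hz
      · rfl
      · exact hne z hz
    rw [he] at htot
    refine (ENNReal.add_left_inj ?_).1 htot
    refine ne_top_of_le_ne_top htop (ENNReal.tsum_le_tsum fun z => ?_)
    split_ifs <;> simp
  refine ⟨PMF.normalize ν hzero htop, ?_⟩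
  ext z
  rw [PMF.bind_apply, PMF.normalize_apply]
  simp only [PMF.normalize_apply]
  have hz : ∑' y, ν y * P y z = ν z := by
    by_cases hzx : z = x
    · rw [hzx]; exact hx
    · exact hne z hzx
  rw [← hz, ← ENNReal.tsum_mul_right]
  exact tsum_congr fun y => by ring

theorem tsum_stationary_mul_step {P : X → PMF X} {μ : PMF X} (hμ : μ.bind P = μ)
    (f : X → ℝ≥0∞) : ∑' x, μ x * step P f x = ∑' x, μ x * f x := by
  conv_rhs => rw [← hμ]
  simp only [PMF.bind_apply, step, ← ENNReal.tsum_mul_left, ← ENNReal.tsum_mul_right]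
  rw [ENNReal.tsum_comm]
  exact tsum_congr fun y => tsum_congr fun x => by ring

theorem iterate_step_le (P : X → PMF X) {V c : X → ℝ≥0∞} {b : ℝ≥0∞}
    (hdrift : ∀ x, step P V x + c x ≤ V x + b) (N : ℕ) (x : X) :
    ∑ n ∈ Finset.range N, (step P)^[n] c x ≤ V x + N * b := by
  have key : ∀ (N : ℕ) x, (step P (fun z => V z + N * b)) x = step P V x + N * b := by
    intro N x
    have := congrFun (step_add P V fun _ => N * b) x
    simp only [Pi.add_apply] at this
    refine this.trans ?_
    congr 1
    simp [step, ENNReal.tsum_mul_right, (P x).tsum_coe]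
  induction N generalizing x with
  | zero => simp
  | succ N ih =>
    have h : ∑ n ∈ Finset.range N, (step P)^[n + 1] c x =
        step P (fun z => ∑ n ∈ Finset.range N, (step P)^[n] c z) x := by
      simp only [Function.iterate_succ_apply', step, Finset.mul_sum]
      exact (Summable.tsum_finsetSum fun n _ => ENNReal.summable).symm
    rw [Finset.sum_range_succ', h]
    calc _ ≤ step P V x + N * b + c x := by
          rw [← key]
          exact add_le_add_left (step_mono P ih x) _
      _ = (step P V x + c x) + N * b := by ring
      _ ≤ V x + b + N * b := by exact add_le_add_left (hdrift x) _
      _ = _ := by push_cast; ring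

/-- Under a drift condition the stationary mean of `c` is at most the drift constant. -/
theorem tsum_stationary_mul_le {P : X → PMF X} {V c : X → ℝ≥0∞} {b : ℝ≥0∞}
    (hV : ∀ x, V x ≠ ∞) (hc : ∀ x, c x ≠ ∞) (hdrift : ∀ x, step P V x + c x ≤ V x + b)
    {μ : PMF X} (hμ : μ.bind P = μ) : ∑' x, μ x * c x ≤ b := by
  have hiter : ∀ (n : ℕ) (f : X → ℝ≥0∞), ∑' x, μ x * (step P)^[n] f x = ∑' x, μ x * f x := by
    intro n f
    induction n with
    | zero => rfl
    | succ n ih => rw [Function.iterate_succ_apply', tsum_stationary_mul_step hμ, ih]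
  -- The stationary mean of `V` may be infinite, so the drift inequality cannot be integrated
  -- directly. The cost is truncated at `k` and averaged over `N` steps, which leaves the bounded
  -- error `min k (V / N)`.
  have htrunc : ∀ k : ℝ≥0∞, k ≠ ∞ → ∑' x, μ x * min k (c x) ≤ b := by
    intro k hk
    set ck : X → ℝ≥0∞ := fun x => min k (c x) with hck
    have hN : ∀ N : ℕ, N ≠ 0 → ∑' x, μ x * ck x ≤ b + ∑' x, μ x * min k (V x / N) := by
      intro N hN
      have hN0 : (N : ℝ≥0∞) ≠ 0 := by exact_mod_cast hN
      have hNt : (N : ℝ≥0∞) ≠ ∞ := ENNReal.natCast_ne_top N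
      have h1 : ∀ x, ∑ n ∈ Finset.range N, (step P)^[n] ck x ≤
          N * (b + min k (V x / N)) := by
        intro x
        have hk' : ∀ n, (step P)^[n] ck ≤ fun _ => k := by
          intro n
          induction n with
          | zero => exact fun x => min_le_left _ _
          | succ n ih =>
            rw [Function.iterate_succ_apply']
            intro x
            refine (step_mono P ih x).trans_eq ?_
            simp [step, ENNReal.tsum_mul_right, (P x).tsum_coe]
        rcases le_total k (V x / N) with h | h
        · rw [min_eq_left h]
          calc _ ≤ ∑ n ∈ Finset.range N, k := Finset.sum_le_sum fun n _ => hk' n x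
            _ = N * k := by simp
            _ ≤ _ := by gcongr; exact le_add_self
        · rw [min_eq_right h, mul_add, ENNReal.mul_div_cancel hN0 hNt, add_comm]
          exact iterate_step_le P (fun x => (add_le_add_right (min_le_right _ _) _).trans
            (hdrift x)) N x
      have h2 : N * ∑' x, μ x * ck x ≤ N * (b + ∑' x, μ x * min k (V x / N)) := by
        calc _ = ∑ n ∈ Finset.range N, ∑' x, μ x * (step P)^[n] ck x := by
              simp only [hiter]; simp
          _ = ∑' x, μ x * ∑ n ∈ Finset.range N, (step P)^[n] ck x := by
              simp only [Finset.mul_sum]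
              exact (Summable.tsum_finsetSum fun n _ => ENNReal.summable).symm
          _ ≤ ∑' x, μ x * (N * (b + min k (V x / N))) :=
              ENNReal.tsum_le_tsum fun x => mul_le_mul_right (h1 x) _
          _ = _ := by
              have : ∀ x, μ x * (N * (b + min k (V x / N))) =
                  N * (μ x * b) + N * (μ x * min k (V x / N)) := fun x => by ring
              simp only [this]
              rw [ENNReal.tsum_add, ENNReal.tsum_mul_left, ENNReal.tsum_mul_left,
                ENNReal.tsum_mul_right, μ.tsum_coe, one_mul, mul_add]
      exact (ENNReal.mul_le_mul_iff_right hN0 hNt).1 h2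
    -- Dominated convergence with the constant bound `k`, since `V` is finite at each state.
    have hlim : Filter.Tendsto (fun N : ℕ => ∑' x, μ x * min k (V x / N)) Filter.atTop
        (nhds 0) := by
      let _ : MeasurableSpace X := ⊤
      have : DiscreteMeasurableSpace X := ⟨fun _ => trivial⟩
      simp only [← PMF.lintegral_eq_tsum_mul]
      have := tendsto_lintegral_of_dominated_convergence (μ := μ.toMeasure)
        (F := fun (N : ℕ) x => min k (V x / N)) (f := fun _ => 0) (fun _ => k)
        (fun _ => Measurable.of_discrete) (fun _ => Filter.Eventually.of_forall fun x =>
          min_le_left _ _) (by simpa using hk) (Filter.Eventually.of_forall fun x => ?_)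
      · simpa using this
      · refine tendsto_of_tendsto_of_tendsto_of_le_of_le tendsto_const_nhds
          (h := fun N : ℕ => V x / N) ?_ (fun _ => zero_le) fun N => min_le_right _ _
        simpa using ENNReal.Tendsto.const_div ENNReal.tendsto_nat_nhds_top (Or.inr (hV x))
    refine ge_of_tendsto (x := Filter.atTop) (f := fun N : ℕ => b + ∑' x, μ x * min k (V x / N))
      (by simpa using hlim.const_add b) ?_
    filter_upwards [Filter.eventually_ne_atTop 0] with N h using hN N h
  refine ENNReal.summable.tsum_le_of_sum_le fun s => ?_
  have hk : s.sup c ≠ ∞ := by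
    refine ne_of_lt ((Finset.sup_lt_iff (by simp)).2 fun x _ => (hc x).lt_top)
  refine le_trans ?_ (htrunc _ hk)
  refine le_trans (Finset.sum_le_sum fun x hx => ?_) (ENNReal.sum_le_tsum s)
  rw [min_eq_right (Finset.le_sup hx)]

end MChain

/-! ### Foster–Lyapunov criteria -/

namespace MChain

variable {X : Type*} [MeasurableSpace X] [DiscreteMeasurableSpace X]

/-- Foster-Lyapunov criterion: an irreducible chain with a drift of at least the cost `c ≥ 1` outside
a finite set is `c`-regular. -/
theorem cRegular_of_drift {P : X → PMF X} (hirr : Irreducible P) {V c : X → ℝ≥0∞}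
    {b : ℝ≥0∞} (hb : b ≠ ∞) {F : Set X} (hF : F.Finite) (hV : ∀ x, V x ≠ ∞)
    (hdrift : ∀ x, step P V x + c x ≤ V x + b * F.indicator 1 x) : CRegular P c := by
  refine ⟨fun i => {x | V x ≤ i}, fun i A hA => ?_, ?_⟩
  · obtain ⟨B, hB, h⟩ := exists_tsum_iterate_tabooStep_le hirr hb hF hdrift hA
    refine lt_of_le_of_lt (b := (i : ℝ≥0∞) + B) (iSup₂_le fun x hx => ?_)
      (ENNReal.add_lt_top.2 ⟨ENNReal.natCast_lt_top i, hB.lt_top⟩)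
    rw [costToPassage_eq_tsum]
    exact (h x).trans (add_le_add_left hx _)
  · refine Set.eq_univ_of_forall fun x => ?_
    obtain ⟨n, hn⟩ := ENNReal.exists_nat_gt (hV x)
    exact Set.mem_iUnion.2 ⟨n, hn.le⟩

/-- Foster-Lyapunov criterion: an irreducible chain with a drift of at least the cost `c ≥ 1` outside
a finite set is stable, for every size function bounded by a multiple of `c`. -/
theorem stable_of_drift [Nonempty X] {P : X → PMF X} (hirr : Irreducible P) {V c : X → ℝ≥0∞}
    {b : ℝ≥0∞} (hb : b ≠ ∞) {F : Set X} (hF : F.Finite) (hV : ∀ x, V x ≠ ∞) (hc : ∀ x, c x ≠ ∞)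
    (hc1 : ∀ x, 1 ≤ c x) (hdrift : ∀ x, step P V x + c x ≤ V x + b * F.indicator 1 x)
    {size : X → ℕ} {a : ℝ≥0∞} (ha : a ≠ ∞) (hsize : ∀ x, (size x : ℝ≥0∞) ≤ a * c x) :
    Stable P size := by
  have hfin : ∀ x, ∑' n, (tabooStep P {x})^[n] 1 x ≠ ∞ := by
    intro x
    obtain ⟨B, hB, h⟩ :=
      exists_tsum_iterate_tabooStep_le hirr hb hF hdrift (Set.singleton_nonempty x)
    refine ne_top_of_le_ne_top (ENNReal.add_ne_top.2 ⟨hV x, hB⟩) (le_trans ?_ (h x))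
    exact ENNReal.tsum_le_tsum fun n => (tabooStep_mono P {x}).iterate n hc1 x
  refine ⟨fun x => ?_, ?_, fun μ hμ => ?_⟩
  · rw [costToPassage_eq_tsum]
    exact (hfin x).lt_top
  · exact exists_stationary (hfin (Classical.arbitrary X))
  · have hdrift' : ∀ x, step P V x + c x ≤ V x + b := fun x =>
      (hdrift x).trans (add_le_add_right (mul_le_of_le_one_right'
        (Set.indicator_le_self F (1 : X → ℝ≥0∞) x)) _)
    calc ∑' x, μ x * (size x : ℝ≥0∞) ≤ ∑' x, a * (μ x * c x) :=
          ENNReal.tsum_le_tsum fun x => by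
            rw [mul_left_comm]
            exact mul_le_mul_right (hsize x) _
      _ = a * ∑' x, μ x * c x := ENNReal.tsum_mul_left
      _ ≤ a * b := mul_le_mul_right (tsum_stationary_mul_le hV hc hdrift' hμ) _
      _ < ∞ := ENNReal.mul_lt_top ha.lt_top hb.lt_top

end MChain

/-! ### Extended expectations -/

namespace PMF

variable {X Y : Type*}

/-- The expectation of a nonnegative function. -/
def lexp (p : PMF X) (f : X → ℝ≥0∞) : ℝ≥0∞ := ∑' x, p x * f x

theorem lexp_mono (p : PMF X) {f g : X → ℝ≥0∞} (h : ∀ x, f x ≤ g x) : p.lexp f ≤ p.lexp g :=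
  ENNReal.tsum_le_tsum fun x => mul_le_mul_right (h x) _

theorem lexp_add (p : PMF X) (f g : X → ℝ≥0∞) :
    p.lexp (fun x => f x + g x) = p.lexp f + p.lexp g := by
  simp only [lexp, mul_add]
  exact ENNReal.tsum_add

theorem lexp_const (p : PMF X) (a : ℝ≥0∞) : p.lexp (fun _ => a) = a := by
  rw [lexp, ENNReal.tsum_mul_right, p.tsum_coe, one_mul]

theorem lexp_const_mul (p : PMF X) (a : ℝ≥0∞) (f : X → ℝ≥0∞) :
    p.lexp (fun x => a * f x) = a * p.lexp f := by
  simp only [lexp, mul_left_comm _ a]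
  exact ENNReal.tsum_mul_left

theorem lexp_sum {ι : Type*} (p : PMF X) (s : Finset ι) (f : ι → X → ℝ≥0∞) :
    p.lexp (fun x => ∑ i ∈ s, f i x) = ∑ i ∈ s, p.lexp (f i) := by
  simp only [lexp, Finset.mul_sum]
  exact Summable.tsum_finsetSum fun _ _ => ENNReal.summable

theorem lexp_bind (p : PMF X) (q : X → PMF Y) (f : Y → ℝ≥0∞) :
    (p.bind q).lexp f = p.lexp fun x => (q x).lexp f := by
  simp only [lexp, bind_apply, ← ENNReal.tsum_mul_right, ← ENNReal.tsum_mul_left]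
  rw [ENNReal.tsum_comm]
  exact tsum_congr fun x => tsum_congr fun y => mul_assoc _ _ _

theorem lexp_map (p : PMF X) (g : X → Y) (f : Y → ℝ≥0∞) :
    (p.map g).lexp f = p.lexp fun x => f (g x) := by
  rw [map, lexp_bind]
  congr 1
  funext x
  rw [lexp, tsum_eq_single (g x)]
  · simp
  · intro y hy
    simp [hy]

theorem lexp_ofReal [Fintype X] (p : PMF X) {f : X → ℝ} (hf : ∀ x, 0 ≤ f x) :
    p.lexp (fun x => ENNReal.ofReal (f x)) = ENNReal.ofReal (∑ x, (p x).toReal * f x) := by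
  rw [lexp, tsum_fintype, ENNReal.ofReal_sum_of_nonneg fun x _ =>
    mul_nonneg ENNReal.toReal_nonneg (hf x)]
  refine Finset.sum_congr rfl fun x _ => ?_
  rw [ENNReal.ofReal_mul ENNReal.toReal_nonneg, ENNReal.ofReal_toReal (p.apply_ne_top x)]

end PMF

theorem lexp_arrivalLaw {J : ℕ} (arr : Fin J → PMF ℕ) (j : Fin J) (f : ℕ → ℝ≥0∞) :
    (arrivalLaw arr).lexp (fun a => f (a j)) = (arr j).lexp f := by
  have h := PMF.lintegral_eq_tsum_mul (arrivalLaw arr) fun a => f (a j)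
  rw [PMF.lexp, ← h, arrivalLaw, Measure.toPMF_toMeasure,
    (measurePreserving_eval (fun j => (arr j).toMeasure) j).lintegral_comp
      (Measurable.of_discrete (f := f)), PMF.lintegral_eq_tsum_mul]
  rfl

theorem summable_batchMean {q : PMF ℕ} (hq : Summable fun k : ℕ => (q k).toReal * (k : ℝ) ^ 2) :
    Summable fun k : ℕ => (q k).toReal * (k : ℝ) := by
  refine Summable.of_nonneg_of_le (fun k => by positivity) (fun k => ?_) hq
  gcongr
  have : (k : ℝ) = (k : ℝ) ^ 1 := (pow_one _).symm
  exact_mod_cast Nat.le_self_pow two_ne_zero k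

theorem lexp_natCast {q : PMF ℕ} (hq : Summable fun k : ℕ => (q k).toReal * (k : ℝ) ^ 2) :
    q.lexp (fun k => (k : ℝ≥0∞)) = ENNReal.ofReal (batchMean q) := by
  rw [batchMean, ENNReal.ofReal_tsum_of_nonneg (fun k => by positivity) (summable_batchMean hq)]
  refine tsum_congr fun k => ?_
  rw [ENNReal.ofReal_mul ENNReal.toReal_nonneg, ENNReal.ofReal_toReal (q.apply_ne_top k),
    ENNReal.ofReal_natCast]

theorem lexp_natCast_sq_ne_top {q : PMF ℕ}
    (hq : Summable fun k : ℕ => (q k).toReal * (k : ℝ) ^ 2) :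
    q.lexp (fun k => (k : ℝ≥0∞) ^ 2) ≠ ∞ := by
  have : q.lexp (fun k => (k : ℝ≥0∞) ^ 2) =
      ENNReal.ofReal (∑' k : ℕ, (q k).toReal * (k : ℝ) ^ 2) := by
    rw [ENNReal.ofReal_tsum_of_nonneg (fun k => by positivity) hq]
    refine tsum_congr fun k => ?_
    rw [ENNReal.ofReal_mul ENNReal.toReal_nonneg, ENNReal.ofReal_toReal (q.apply_ne_top k),
      ENNReal.ofReal_pow (by positivity), ENNReal.ofReal_natCast]
  rw [this]
  exact ENNReal.ofReal_ne_top

/-! ### Drift on a closed set and its rescaling -/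

namespace MChain

variable {X : Type*}

theorem step_restrict_le (P : X → PMF X) (C : Set X) (hC : Closed P C) (V : X → ℝ≥0∞) (x : C) :
    step (restrict P C hC) (fun y => V y) x ≤ step P V x :=
  ENNReal.tsum_comp_le_tsum_of_injective Subtype.val_injective fun y => P x y * V y

/-- A uniformly bounded excess over a drift of `2 * e * c` is absorbed, by half of that drift,
outside a sublevel set of `c`. -/
theorem drift_rescale {P : X → PMF X} {V c : X → ℝ≥0∞} {e B : ℝ≥0∞} (he0 : e ≠ 0) (het : e ≠ ∞)
    (hB : B ≠ ∞) (h : ∀ x, step P V x + 2 * e * c x ≤ V x + B) (x : X) :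
    step P (fun y => e⁻¹ * V y) x + c x ≤
      e⁻¹ * V x + e⁻¹ * B * {x | c x ≤ e⁻¹ * B}.indicator 1 x := by
  have key : step P V x + e * c x ≤ V x + B * {x | c x ≤ e⁻¹ * B}.indicator 1 x := by
    by_cases hx : c x ≤ e⁻¹ * B
    · rw [Set.indicator_of_mem (by exact hx), Pi.one_apply, mul_one]
      refine le_trans ?_ (h x)
      rw [two_mul, add_mul]
      exact add_le_add_right le_self_add _
    · rw [Set.indicator_of_notMem (by exact hx), mul_zero, add_zero]
      refine (ENNReal.add_le_add_iff_right hB).1 (le_trans ?_ (h x))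
      have : B ≤ e * c x := by
        calc B = e * (e⁻¹ * B) := by rw [← mul_assoc, ENNReal.mul_inv_cancel he0 het, one_mul]
          _ ≤ _ := mul_le_mul_right (not_le.1 hx).le _
      rw [two_mul, add_mul, ← add_assoc]
      exact add_le_add_right this _
  calc _ = e⁻¹ * (step P V x + e * c x) := by
        rw [step_const_mul, mul_add, ← mul_assoc e⁻¹ e, ENNReal.inv_mul_cancel he0 het, one_mul]
    _ ≤ e⁻¹ * (V x + B * {x | c x ≤ e⁻¹ * B}.indicator 1 x) := mul_le_mul_right key _
    _ = _ := by ring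

end MChain

theorem List.finite_setOf_forall_mem_of_length_le {α : Type*} {R : Set α} (hR : R.Finite) (n : ℕ) :
    {l : List α | (∀ x ∈ l, x ∈ R) ∧ l.length ≤ n}.Finite := by
  have := hR.to_subtype
  refine ((List.finite_length_le R n).image (List.map Subtype.val)).subset ?_
  rintro l ⟨h, hl⟩
  refine ⟨l.attach.map fun x => ⟨x.1, h x.1 x.2⟩, by simpa using hl, ?_⟩
  simp

/-! ### The weight of a queue over one time-slot -/

namespace State

variable {J K : ℕ}

/-- The total weight of a queue: its residual requirements, each increased by `b`. -/
def weight (b : ℝ) (l : List ℝ) : ℝ := (l.map fun x => x + b).sum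

theorem weight_append (b : ℝ) (l m : List ℝ) : weight b (l ++ m) = weight b l + weight b m := by
  simp [weight]

theorem weight_cons (b x : ℝ) (l : List ℝ) : weight b (x :: l) = x + b + weight b l := by
  simp [weight]

theorem weight_replicate (b x : ℝ) (n : ℕ) :
    weight b (List.replicate n x) = n * (x + b) := by
  simp [weight, mul_add]

theorem length_mul_le_weight {b : ℝ} {l : List ℝ} (hl : ∀ x ∈ l, 0 < x) :
    l.length * b ≤ weight b l := by
  induction l with
  | nil => simp [weight]
  | cons x l ih =>
    have h1 := hl x (by simp)
    have h2 := ih fun y hy => hl y (by simp [hy])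
    rw [weight_cons, List.length_cons]
    push_cast
    linarith

theorem weight_le_length_mul {b S : ℝ} {l : List ℝ} (hl : ∀ x ∈ l, x ≤ S) :
    weight b l ≤ l.length * (S + b) := by
  induction l with
  | nil => simp [weight]
  | cons x l ih =>
    have h1 := hl x (by simp)
    have h2 := ih fun y hy => hl y (by simp [hy])
    rw [weight_cons, List.length_cons]
    push_cast
    linarith

open Classical in
-- A message that leaves has `x > 0`, so its weight `x + b` exceeds `f` even if the quantum was
-- larger than its residual. This is why the weight contains `b`.
theorem weight_served_le {b f : ℝ} (hfb : f ≤ b) {l : List ℝ}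
    (hl : ∀ x ∈ l, 0 < x) :
    weight b ((l.map fun x => x - f).filter (fun x => 0 < x)) + l.length * f ≤ weight b l := by
  induction l with
  | nil => simp [weight]
  | cons x l ih =>
    have h1 := hl x (by simp)
    have h2 := ih fun y hy => hl y (by simp [hy])
    rw [weight_cons, List.map_cons, List.length_cons]
    push_cast
    by_cases hx : 0 < x - f
    · rw [List.filter_cons_of_pos (by simpa using hx), weight_cons]
      linarith
    · rw [List.filter_cons_of_neg (by simpa using hx)]
      linarith

theorem weight_next_le {φ : Schedule J K → Fin J → ℝ} {S : Fin J → ℝ} {α : State J}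
    {t : Schedule J K} {a : Fin J → ℕ} {j : Fin J} {b : ℝ} (hφb : φ t j ≤ b)
    (ht : t.1 j ≤ (α j).length) (hα : ∀ x ∈ α j, 0 < x) :
    weight b (next φ S α t a j) + t.1 j * φ t j ≤ weight b (α j) + a j * (S j + b) := by
  have h := weight_served_le hφb (l := (α j).take (t.1 j)) fun x hx => hα x (List.mem_of_mem_take hx)
  rw [List.length_take, min_eq_left ht] at h
  have h2 : weight b (α j) = weight b ((α j).take (t.1 j)) + weight b ((α j).drop (t.1 j)) := by
    rw [← weight_append, List.take_append_drop]
  rw [next, weight_append, weight_append, weight_replicate, h2]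
  linarith

theorem next_pos {φ : Schedule J K → Fin J → ℝ} {S : Fin J → ℝ} {α : State J}
    {t : Schedule J K} {a : Fin J → ℕ} {j : Fin J} (hS : 0 < S j) (hα : ∀ x ∈ α j, 0 < x) :
    ∀ x ∈ next φ S α t a j, 0 < x := by
  intro x hx
  simp only [next, List.mem_append, List.mem_filter, List.mem_replicate] at hx
  rcases hx with (hx | hx) | hx
  · simpa using hx.2
  · exact hα x (List.mem_of_mem_drop hx)
  · rw [hx.2]; exact hS

end State

/-- Positive service quanta, not decreased by fewer interferers. -/
structure IsQuantum {J K : ℕ} (φ : Schedule J K → Fin J → ℝ) : Prop where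
  eq_zero : ∀ s j, s.1 j = 0 → φ s j = 0
  pos : ∀ s j, 0 < s.1 j → 0 < φ s j
  mono : ∀ s t j, (∀ i, t.1 i ≤ s.1 i) → t.1 j = s.1 j → φ s j ≤ φ t j

/-! ### Finiteness of residuals and the drift of one queue -/

namespace IsQuantum

variable {J K : ℕ} {φ : Schedule J K → Fin J → ℝ}

theorem nonneg (h : IsQuantum φ) (s : Schedule J K) (j : Fin J) : 0 ≤ φ s j := by
  rcases Nat.eq_zero_or_pos (s.1 j) with hs | hs
  · exact (h.eq_zero s j hs).ge
  · exact (h.pos s j hs).le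

theorem le_maxQuantum (φ : Schedule J K → Fin J → ℝ) (s : Schedule J K) (j : Fin J) :
    φ s j ≤ maxQuantum φ j :=
  Finset.le_sup' (fun s => φ s j) (Finset.mem_univ s)

theorem maxQuantum_pos (h : IsQuantum φ) (hK : 1 ≤ K) (j : Fin J) : 0 < maxQuantum φ j := by
  refine (h.pos ⟨Pi.single j 1, by simpa using hK⟩ j (by simp)).trans_le (le_maxQuantum φ _ j)

/-- Nonzero quanta are bounded below, so a positive residual has received only boundedly many of
them. -/
theorem finite_residuals (h : IsQuantum φ) (S : Fin J → ℝ) (j : Fin J) :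
    (State.residuals φ S j).Finite := by
  obtain ⟨δ, hδ, hle⟩ : ∃ δ : ℝ, 0 < δ ∧ ∀ s, φ s j ≠ 0 → δ ≤ φ s j := by
    -- Zero quanta are replaced by `1`, so that the minimum is positive and exists even if all
    -- quanta vanish.
    obtain ⟨s₀, hs₀⟩ := Finite.exists_min fun s => if φ s j = 0 then 1 else φ s j
    refine ⟨if φ s₀ j = 0 then 1 else φ s₀ j, ?_, fun s hs => ?_⟩
    · split_ifs with h0
      · exact one_pos
      · exact lt_of_le_of_ne (h.nonneg s₀ j) (Ne.symm h0)
    · simpa [hs] using hs₀ s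
  -- Schedules with zero quantum are deleted: the sum is unchanged and the length becomes bounded by
  -- it.
  have hsum : ∀ l : List (Schedule J K), ∃ l' : List (Schedule J K),
      (l'.map fun s => φ s j).sum = (l.map fun s => φ s j).sum ∧
      l'.length * δ ≤ (l.map fun s => φ s j).sum := by
    intro l
    induction l with
    | nil => exact ⟨[], by simp⟩
    | cons s l ih =>
      obtain ⟨l', h1, h2⟩ := ih
      by_cases hs : φ s j = 0
      · exact ⟨l', by simp [hs, h1], by simpa [hs] using h2⟩
      · refine ⟨s :: l', by simp [h1], ?_⟩
        have := hle s hs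
        simp only [List.length_cons, List.map_cons, List.sum_cons]
        push_cast
        linarith
  refine ((List.finite_length_le (Schedule J K) ⌊S j / δ⌋₊).image
    fun l => S j - (l.map fun s => φ s j).sum).subset ?_
  rintro x ⟨hx, l, rfl⟩
  obtain ⟨l', h1, h2⟩ := hsum l
  refine ⟨l', ?_, by simp only [h1]⟩
  refine Nat.le_floor ?_
  rw [le_div_iff₀ hδ]
  linarith

theorem le_of_mem_residuals (h : IsQuantum φ) {S : Fin J → ℝ} {j : Fin J} {x : ℝ}
    (hx : x ∈ State.residuals φ S j) : x ≤ S j := by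
  obtain ⟨_, l, rfl⟩ := hx
  have : 0 ≤ (l.map fun s => φ s j).sum := by
    refine List.sum_nonneg fun y hy => ?_
    obtain ⟨s, _, rfl⟩ := List.mem_map.1 hy
    exact h.nonneg s j
  linarith

/-- The quadratic drift inequality for one queue in one time-slot. -/
theorem sq_weight_next_le (h : IsQuantum φ) {S : Fin J → ℝ} (hS : ∀ j, 0 < S j) (hK : 1 ≤ K)
    {α : State J} (hα : α ∈ State.vectors φ S) (s : Schedule J K) (a : Fin J → ℕ) (j : Fin J) :
    State.weight (maxQuantum φ j) (State.next φ S α (State.maxSub s α) a j) ^ 2 +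
        2 * State.weight (maxQuantum φ j) (α j) * (s.1 j * φ s j) ≤
      State.weight (maxQuantum φ j) (α j) ^ 2 +
        2 * State.weight (maxQuantum φ j) (α j) * (S j + maxQuantum φ j) * a j +
        (S j + maxQuantum φ j) ^ 2 * (a j : ℝ) ^ 2 +
        ((K * maxQuantum φ j) ^ 2 +
          2 * (K * (S j + maxQuantum φ j)) * (K * maxQuantum φ j)) := by
  set b := maxQuantum φ j with hb
  set t := State.maxSub s α with ht
  have hb0 : 0 < b := h.maxQuantum_pos hK j
  have hpos : ∀ x ∈ α j, 0 < x := fun x hx => (hα j x hx).1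
  have htl : t.1 j ≤ (α j).length := min_le_right _ _
  have hW := State.weight_next_le (S := S) (a := a) (le_maxQuantum φ t j) htl hpos
  rw [← hb] at hW
  have hW0 : 0 ≤ State.weight b (State.next φ S α t a j) :=
    (by positivity : (0 : ℝ) ≤ _).trans (State.length_mul_le_weight (State.next_pos (hS j) hpos))
  have hw0 : 0 ≤ State.weight b (α j) :=
    (by positivity : (0 : ℝ) ≤ _).trans (State.length_mul_le_weight hpos)
  have hsK : (s.1 j : ℝ) ≤ K := by
    exact_mod_cast (Finset.single_le_sum (f := s.1) (fun _ _ => Nat.zero_le _)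
      (Finset.mem_univ j)).trans s.2
  have hd0 : 0 ≤ s.1 j * φ s j := mul_nonneg (by positivity) (h.nonneg s j)
  have hdK : s.1 j * φ s j ≤ K * b :=
    mul_le_mul hsK (le_maxQuantum φ s j) (h.nonneg s j) (by positivity)
  have hg : 0 < S j + b := add_pos (hS j) hb0
  have hG : 0 ≤ a j * (S j + b) := by positivity
  set W := State.weight b (State.next φ S α t a j)
  set w := State.weight b (α j)
  set d := s.1 j * φ s j
  set G := a j * (S j + b) with hGdef
  have hd2 : d ^ 2 ≤ (K * b) ^ 2 := pow_le_pow_left₀ hd0 hdK 2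
  have hC : 0 ≤ K * (S j + b) := by positivity
  have hsq : w ^ 2 + 2 * w * (S j + b) * a j + (S j + b) ^ 2 * (a j : ℝ) ^ 2 = (w + G) ^ 2 := by
    rw [hGdef]; ring
  rw [hsq]
  -- With enough messages the full service `d` is realised, and `d ^ 2` is the only excess.
  -- Otherwise fewer than `K` messages are present and `2 * w * d` itself is bounded.
  rcases le_or_gt (s.1 j) (α j).length with hs | hs
  · have htj : t.1 j = s.1 j := min_eq_left hs
    have hm : φ s j ≤ φ t j := h.mono s t j (fun i => min_le_left _ _) htj
    have hd : d ≤ t.1 j * φ t j := by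
      rw [htj]; exact mul_le_mul_of_nonneg_left hm (by positivity)
    have hle : W ≤ w + G - d := by linarith
    have := pow_le_pow_left₀ hW0 hle 2
    have h3 : 0 ≤ 2 * (K * (S j + b)) * (K * b) := by positivity
    nlinarith [mul_nonneg hG hd0]
  · have hle : W ≤ w + G := by
      have : 0 ≤ t.1 j * φ t j := mul_nonneg (by positivity) (h.nonneg t j)
      linarith
    have h1 := pow_le_pow_left₀ hW0 hle 2
    have hwC : w ≤ K * (S j + b) := by
      refine (State.weight_le_length_mul fun x hx => h.le_of_mem_residuals (hα j x hx)).trans ?_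
      have : ((α j).length : ℝ) ≤ K := le_trans (by exact_mod_cast hs.le) hsK
      exact mul_le_mul_of_nonneg_right this hg.le
    have h2 : w * d ≤ K * (S j + b) * (K * b) := mul_le_mul hwC hdK hd0 hC
    have h3 : 0 ≤ (K * b) ^ 2 := by positivity
    linarith

end IsQuantum

/-! ### Averaged drift and stability of the queue -/

namespace IsQuantum

variable {J K : ℕ} {φ : Schedule J K → Fin J → ℝ}

/-- The averaged quadratic drift inequality for one queue. -/
theorem lexp_sq_weight_next_le (h : IsQuantum φ) {S : Fin J → ℝ} (hS : ∀ j, 0 < S j) (hK : 1 ≤ K)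
    {arr : Fin J → PMF ℕ} {j : Fin J}
    (harr : Summable fun k : ℕ => (arr j k).toReal * (k : ℝ) ^ 2)
    (pω : PMF (Schedule J K)) {ε : ℝ} (hε : 0 ≤ ε)
    (hstab : (S j + maxQuantum φ j) * batchMean (arr j) + ε ≤
      ∑ s, (pω s).toReal * ((s.1 j : ℝ) * φ s j)) :
    ∃ B : ℝ≥0∞, B ≠ ∞ ∧ ∀ α ∈ State.vectors φ S,
      (pω.lexp fun s => (arrivalLaw arr).lexp fun a => ENNReal.ofReal
        (State.weight (maxQuantum φ j) (State.next φ S α (State.maxSub s α) a j) ^ 2)) +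
        2 * ENNReal.ofReal ε * ENNReal.ofReal (State.weight (maxQuantum φ j) (α j)) ≤
      ENNReal.ofReal (State.weight (maxQuantum φ j) (α j) ^ 2) + B := by
  set b := maxQuantum φ j with hb
  set g := S j + b with hgdef
  set D := (K * b) ^ 2 + 2 * (K * g) * (K * b) with hD
  have hb0 : 0 < b := h.maxQuantum_pos hK j
  have hg : 0 < g := add_pos (hS j) hb0
  have hD0 : 0 ≤ D := by positivity
  refine ⟨ENNReal.ofReal (g ^ 2) * (arr j).lexp (fun k => (k : ℝ≥0∞) ^ 2) + ENNReal.ofReal D,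
    ENNReal.add_ne_top.2 ⟨ENNReal.mul_ne_top ENNReal.ofReal_ne_top (lexp_natCast_sq_ne_top harr),
      ENNReal.ofReal_ne_top⟩, fun α hα => ?_⟩
  set w := State.weight b (α j) with hw
  have hw0 : 0 ≤ w := (by positivity : (0 : ℝ) ≤ _).trans
    (State.length_mul_le_weight fun x hx => (hα j x hx).1)
  have hm0 : 0 ≤ batchMean (arr j) := tsum_nonneg fun k => by positivity
  have hd0 : ∀ s : Schedule J K, 0 ≤ (s.1 j : ℝ) * φ s j := fun s =>
    mul_nonneg (by positivity) (h.nonneg s j)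
  -- Decrements are kept as additions on the left, since extended nonnegative reals have no true
  -- subtraction.
  have hpt : ∀ (s : Schedule J K) (a : Fin J → ℕ),
      ENNReal.ofReal (State.weight b (State.next φ S α (State.maxSub s α) a j) ^ 2) +
        ENNReal.ofReal (2 * w) * ENNReal.ofReal (s.1 j * φ s j) ≤
      (ENNReal.ofReal (w ^ 2) + ENNReal.ofReal D) +
        (ENNReal.ofReal (2 * w * g) * (a j : ℝ≥0∞) +
          ENNReal.ofReal (g ^ 2) * (a j : ℝ≥0∞) ^ 2) := by
    intro s a
    have h2w : 0 ≤ 2 * w := by positivity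
    rw [← ENNReal.ofReal_natCast, ← ENNReal.ofReal_pow (by positivity),
      ← ENNReal.ofReal_mul h2w, ← ENNReal.ofReal_mul (by positivity),
      ← ENNReal.ofReal_mul (by positivity),
      ← ENNReal.ofReal_add (by positivity) (mul_nonneg h2w (hd0 s)),
      ← ENNReal.ofReal_add (by positivity) hD0,
      ← ENNReal.ofReal_add (by positivity) (by positivity),
      ← ENNReal.ofReal_add (by positivity) (by positivity)]
    refine ENNReal.ofReal_le_ofReal ?_
    have := h.sq_weight_next_le hS hK hα s a j
    linarith
  have havg := pω.lexp_mono fun s => (arrivalLaw arr).lexp_mono (hpt s)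
  simp only [PMF.lexp_add, PMF.lexp_const, PMF.lexp_const_mul] at havg
  rw [lexp_arrivalLaw arr j (fun k => (k : ℝ≥0∞)), lexp_arrivalLaw arr j (fun k => (k : ℝ≥0∞) ^ 2),
    lexp_natCast harr, pω.lexp_ofReal hd0] at havg
  -- The mean arriving work is finite, so it may be added to both sides and cancelled.
  have hX : ENNReal.ofReal (2 * w * g) * ENNReal.ofReal (batchMean (arr j)) ≠ ∞ :=
    ENNReal.mul_ne_top ENNReal.ofReal_ne_top ENNReal.ofReal_ne_top
  refine (ENNReal.add_le_add_iff_right hX).1 ?_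
  have hdrift : 2 * ENNReal.ofReal ε * ENNReal.ofReal w +
      ENNReal.ofReal (2 * w * g) * ENNReal.ofReal (batchMean (arr j)) ≤
      ENNReal.ofReal (2 * w) *
        ENNReal.ofReal (∑ s, (pω s).toReal * ((s.1 j : ℝ) * φ s j)) := by
    rw [show (2 : ℝ≥0∞) = ENNReal.ofReal 2 by simp, ← ENNReal.ofReal_mul (by positivity),
      ← ENNReal.ofReal_mul (by positivity), ← ENNReal.ofReal_mul (by positivity),
      ← ENNReal.ofReal_mul (by positivity), ← ENNReal.ofReal_add (by positivity) (by positivity)]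
    refine ENNReal.ofReal_le_ofReal ?_
    have := mul_le_mul_of_nonneg_left hstab (by positivity : 0 ≤ 2 * w)
    linarith
  rw [add_assoc]
  refine (add_le_add_right hdrift _).trans (havg.trans_eq ?_)
  ring

/-- The quadratic Lyapunov function. -/
def lyapunov (φ : Schedule J K → Fin J → ℝ) (α : State J) : ℝ≥0∞ :=
  ∑ j, ENNReal.ofReal (State.weight (maxQuantum φ j) (α j) ^ 2)

theorem weight_nonneg (h : IsQuantum φ) (hK : 1 ≤ K) {S : Fin J → ℝ} {α : State J}
    (hα : α ∈ State.vectors φ S) (j : Fin J) : 0 ≤ State.weight (maxQuantum φ j) (α j) := by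
  have hb0 := h.maxQuantum_pos hK j
  exact (by positivity : (0 : ℝ) ≤ _).trans
    (State.length_mul_le_weight fun x hx => (hα j x hx).1)

theorem ofReal_costFun (h : IsQuantum φ) (hK : 1 ≤ K) {S : Fin J → ℝ} {α : State J}
    (hα : α ∈ State.vectors φ S) : ENNReal.ofReal (costFun φ α) =
      1 + ∑ j, ENNReal.ofReal (State.weight (maxQuantum φ j) (α j)) := by
  have h0 : ∀ j ∈ Finset.univ, 0 ≤ State.weight (maxQuantum φ j) (α j) :=
    fun j _ => h.weight_nonneg hK hα j
  change ENNReal.ofReal (1 + ∑ j, State.weight (maxQuantum φ j) (α j)) = _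
  rw [ENNReal.ofReal_add zero_le_one (Finset.sum_nonneg h0), ENNReal.ofReal_one,
    ← ENNReal.ofReal_sum_of_nonneg h0]

/-- The drift of the Lyapunov function under the state-independent policy. -/
theorem step_lyapunov_le (h : IsQuantum φ) {S : Fin J → ℝ} (hS : ∀ j, 0 < S j) (hK : 1 ≤ K)
    {arr : Fin J → PMF ℕ} (harr : ∀ j, Summable fun k : ℕ => (arr j k).toReal * (k : ℝ) ^ 2)
    (pω : PMF (Schedule J K)) (hstab : ∀ j, (S j + maxQuantum φ j) * batchMean (arr j) <
      ∑ s, (pω s).toReal * ((s.1 j : ℝ) * φ s j)) :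
    ∃ e B : ℝ≥0∞, e ≠ 0 ∧ e ≠ ∞ ∧ B ≠ ∞ ∧ ∀ α ∈ State.vectors φ S,
      MChain.step (queueChain φ S arr (stateIndependentPolicy pω)) (lyapunov φ) α +
        2 * e * ENNReal.ofReal (costFun φ α) ≤ lyapunov φ α + B := by
  -- `ε` is the least slack in the stability condition over the finitely many classes.
  obtain ⟨ε, hε, hle⟩ : ∃ ε : ℝ, 0 < ε ∧ ∀ j, (S j + maxQuantum φ j) * batchMean (arr j) + ε ≤
      ∑ s, (pω s).toReal * ((s.1 j : ℝ) * φ s j) := by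
    rcases isEmpty_or_nonempty (Fin J) with hJ | hJ
    · exact ⟨1, one_pos, fun j => hJ.elim j⟩
    · obtain ⟨i, hi⟩ := Finite.exists_min fun j =>
        ∑ s, (pω s).toReal * ((s.1 j : ℝ) * φ s j) - (S j + maxQuantum φ j) * batchMean (arr j)
      exact ⟨_, sub_pos.2 (hstab i), fun j => by linarith [hi j]⟩
  choose B hB hdrift using fun j =>
    h.lexp_sq_weight_next_le hS hK (harr j) pω hε.le (hle j)
  set e := ENNReal.ofReal ε with he
  have het : e ≠ ∞ := ENNReal.ofReal_ne_top
  -- The extra `2 * e` accounts for the summand `1` in the cost.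
  refine ⟨e, ∑ j, B j + 2 * e, (ENNReal.ofReal_pos.2 hε).ne', het,
    ENNReal.add_ne_top.2 ⟨ENNReal.sum_ne_top.2 fun j _ => hB j,
      ENNReal.mul_ne_top (by simp) het⟩, fun α hα => ?_⟩
  have hstep : MChain.step (queueChain φ S arr (stateIndependentPolicy pω)) (lyapunov φ) α =
      ∑ j, pω.lexp fun s => (arrivalLaw arr).lexp fun a => ENNReal.ofReal
        (State.weight (maxQuantum φ j) (State.next φ S α (State.maxSub s α) a j) ^ 2) := by
    change (queueChain φ S arr (stateIndependentPolicy pω) α).lexp _ = _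
    rw [queueChain, PMF.lexp_bind, stateIndependentPolicy, PMF.lexp_map]
    simp only [PMF.lexp_map, lyapunov, PMF.lexp_sum]
  rw [hstep, h.ofReal_costFun hK hα, lyapunov, mul_add, mul_one, Finset.mul_sum]
  have := Finset.sum_le_sum fun j (_ : j ∈ Finset.univ) => hdrift j α hα
  rw [Finset.sum_add_distrib, Finset.sum_add_distrib] at this
  calc _ = _ + 2 * e := by rw [add_comm (2 * e), ← add_assoc]
    _ ≤ _ := add_le_add_left this (2 * e)
    _ = _ := add_assoc _ _ _

theorem exists_size_le (h : IsQuantum φ) (hK : 1 ≤ K) (S : Fin J → ℝ) :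
    ∃ a : ℝ, 0 ≤ a ∧ ∀ α ∈ State.vectors φ S, (State.size α : ℝ) ≤ a * costFun φ α := by
  obtain ⟨b, hb, hle⟩ : ∃ b : ℝ, 0 < b ∧ ∀ j, b ≤ maxQuantum φ j := by
    rcases isEmpty_or_nonempty (Fin J) with hJ | hJ
    · exact ⟨1, one_pos, fun j => hJ.elim j⟩
    · obtain ⟨i, hi⟩ := Finite.exists_min (maxQuantum φ)
      exact ⟨_, h.maxQuantum_pos hK i, hi⟩
  refine ⟨b⁻¹, by positivity, fun α hα => ?_⟩
  rw [inv_mul_eq_div, le_div_iff₀ hb, State.size, costFun]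
  push_cast
  rw [Finset.sum_mul]
  refine le_trans (Finset.sum_le_sum fun j _ => ?_) (le_add_of_nonneg_left zero_le_one)
  exact (mul_le_mul_of_nonneg_left (hle j) (by positivity)).trans
    (State.length_mul_le_weight fun x hx => (hα j x hx).1)

/-- The cost bounds the number of messages, and each residual lies in a finite set. -/
theorem finite_costFun_le (h : IsQuantum φ) (hK : 1 ≤ K) (S : Fin J → ℝ) (r : ℝ) :
    {α ∈ State.vectors φ S | costFun φ α ≤ r}.Finite := by
  obtain ⟨a, ha, hle⟩ := h.exists_size_le hK S
  refine (Set.Finite.pi' fun j => List.finite_setOf_forall_mem_of_length_le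
    (h.finite_residuals S j) ⌊a * r⌋₊).subset ?_
  rintro α ⟨hα, hr⟩ j
  refine ⟨hα j, Nat.le_floor ?_⟩
  have h1 : (α j).length ≤ State.size α :=
    Finset.single_le_sum (f := fun j => (α j).length) (fun _ _ => Nat.zero_le _) (Finset.mem_univ j)
  calc ((α j).length : ℝ) ≤ State.size α := by exact_mod_cast h1
    _ ≤ a * costFun φ α := hle α hα
    _ ≤ a * r := mul_le_mul_of_nonneg_left hr ha

/-- The state-independent policy makes the queue `c`-regular and stable. -/
theorem cRegular_and_stable (h : IsQuantum φ) {S : Fin J → ℝ} (hS : ∀ j, 0 < S j) (hK : 1 ≤ K)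
    {arr : Fin J → PMF ℕ} (harr : ∀ j, Summable fun k : ℕ => (arr j k).toReal * (k : ℝ) ^ 2)
    (pω : PMF (Schedule J K)) (hstab : ∀ j, (S j + maxQuantum φ j) * batchMean (arr j) <
      ∑ s, (pω s).toReal * ((s.1 j : ℝ) * φ s j))
    {C : Set (State J)} (hC : C ⊆ State.vectors φ S) (hne : C.Nonempty)
    (hclosed : MChain.Closed (queueChain φ S arr (stateIndependentPolicy pω)) C)
    (hirr : MChain.Irreducible (MChain.restrict _ C hclosed)) :
    MChain.CRegular (MChain.restrict _ C hclosed)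
        (fun α : C => ENNReal.ofReal (costFun φ α.1)) ∧
      MChain.Stable (MChain.restrict _ C hclosed) (fun α : C => State.size α.1) := by
  obtain ⟨e, B, he0, het, hB, hdrift⟩ := h.step_lyapunov_le hS hK harr pω hstab
  obtain ⟨a, ha, hsize⟩ := h.exists_size_le hK S
  have : Nonempty C := hne.to_subtype
  set V : C → ℝ≥0∞ := fun α => lyapunov φ α
  set c : C → ℝ≥0∞ := fun α => ENNReal.ofReal (costFun φ α.1)
  have hdriftC : ∀ α : C, MChain.step (MChain.restrict _ C hclosed) V α + 2 * e * c α ≤ V α + B :=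
    fun α => (add_le_add_left (MChain.step_restrict_le _ C hclosed (lyapunov φ) α) _).trans
      (hdrift α (hC α.2))
  have hresc := MChain.drift_rescale he0 het hB hdriftC
  have hb : e⁻¹ * B ≠ ∞ := ENNReal.mul_ne_top (ENNReal.inv_ne_top.2 he0) hB
  have hF : {α : C | c α ≤ e⁻¹ * B}.Finite := by
    refine Set.Finite.of_finite_image ?_ Subtype.val_injective.injOn
    refine (h.finite_costFun_le hK S (e⁻¹ * B).toReal).subset ?_
    rintro _ ⟨α, hα, rfl⟩
    exact ⟨hC α.2, (ENNReal.ofReal_le_iff_le_toReal hb).1 hα⟩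
  have hV : ∀ α, e⁻¹ * V α ≠ ∞ := fun α => ENNReal.mul_ne_top (ENNReal.inv_ne_top.2 he0)
    (ENNReal.sum_ne_top.2 fun j _ => ENNReal.ofReal_ne_top)
  have hc1 : ∀ α, 1 ≤ c α := fun α => by
    change 1 ≤ ENNReal.ofReal (costFun φ α.1)
    rw [h.ofReal_costFun hK (hC α.2)]
    exact le_self_add
  refine ⟨MChain.cRegular_of_drift hirr hb hF hV hresc,
    MChain.stable_of_drift hirr hb hF hV (fun _ => ENNReal.ofReal_ne_top) hc1 hresc
      (a := ENNReal.ofReal a) ENNReal.ofReal_ne_top fun α => ?_⟩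
  rw [← ENNReal.ofReal_natCast, ← ENNReal.ofReal_mul ha]
  exact ENNReal.ofReal_le_ofReal (hsize α.1 (hC α.2))

end IsQuantum

/-! ### The quanta of the two channels -/

namespace GaussianMAC

variable {J K : ℕ} (ch : GaussianMAC J)

theorem received_pos (j : Fin J) : 0 < ch.received j :=
  mul_pos (pow_pos (norm_pos_iff.2 (ch.gain_ne_zero j)) 2) ch.power_pos

/-- The subtracted `P_j` is the scheduled message's own power, already contained in the sum because
`s_j ≥ 1`; noise makes the rest positive. -/
theorem interference_pos {s : Schedule J K} {j : Fin J} (hs : 0 < s.1 j) :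
    0 < (∑ k, (s.1 k : ℝ) * ch.received k) - ch.received j + ch.N₀ * ch.W := by
  have h1 : (s.1 j : ℝ) * ch.received j ≤ ∑ k, (s.1 k : ℝ) * ch.received k :=
    Finset.single_le_sum (f := fun k => (s.1 k : ℝ) * ch.received k)
      (fun k _ => mul_nonneg (by positivity) (ch.received_pos k).le) (Finset.mem_univ j)
  have h2 : ch.received j ≤ s.1 j * ch.received j :=
    le_mul_of_one_le_left (ch.received_pos j).le (by exact_mod_cast hs)
  have h3 := mul_pos ch.N₀_pos ch.W_pos
  linarith

theorem isQuantum {ρ : ℝ} (hρ : 0 < ρ) : IsQuantum (ch.quantum ρ (K := K)) where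
  eq_zero s j hs := by simp [quantum, hs]
  pos s j hs := by
    rw [quantum, if_pos hs]
    refine mul_pos hρ (Real.log_pos (lt_add_of_pos_right 1 (div_pos (ch.received_pos j) ?_)))
    exact mul_pos (by linarith) (ch.interference_pos hs)
  mono s t j hle heq := by
    rcases Nat.eq_zero_or_pos (s.1 j) with hs | hs
    · simp [quantum, hs, heq]
    · have ht : 0 < t.1 j := heq ▸ hs
      rw [quantum, quantum, if_pos hs, if_pos ht]
      have hd := ch.interference_pos ht
      have hd' := ch.interference_pos hs
      have hr := ch.received_pos j
      have hρ' : 0 < 1 + ρ := by linarith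
      gcongr with k
      · exact (ch.received_pos k).le
      · exact hle k

end GaussianMAC

theorem DiscreteMAC.quantum_eq_zero {J K : ℕ} (ch : DiscreteMAC J K) (ρ : ℝ) {s : Schedule J K}
    {j : Fin J} (hs : s.1 j = 0) : ch.quantum ρ s j = 0 := by
  simp [quantum, hs]

end

theorem mainTheorem10 {J K : ℕ} (hJ : 1 ≤ J) (hK : 1 ≤ K)
    -- the channel and the random-coding parameter
    (ch : Channel J K) (ρ : ℝ) (hρ : 0 < ρ) (hρ1 : ρ ≤ 1)
    -- positive service quanta, and fewer interferers do not decrease them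
    (hpos : ∀ c : DiscreteMAC J K, ch = Channel.discrete c →
      ∀ (s : Schedule J K) (j : Fin J), 0 < s.1 j → 0 < c.quantum ρ s j)
    (hmono : ∀ c : DiscreteMAC J K, ch = Channel.discrete c →
      ∀ (s t : Schedule J K) (j : Fin J), (∀ i, t.1 i ≤ s.1 i) → t.1 j = s.1 j →
        c.quantum ρ s j ≤ c.quantum ρ t j)
    -- the message classes
    (M : Fin J → ℕ) (hM : ∀ j, 1 ≤ M j)
    (pe : Fin J → ℝ) (hpe : ∀ j, 0 < pe j) (hpe1 : ∀ j, pe j ≤ 1)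
    (hS : ∀ j, 0 < serviceRequirement ρ M pe j)
    -- the laws of the batch sizes, with finite second moments
    (arr : Fin J → PMF ℕ)
    (harr : ∀ j, Summable fun k : ℕ => (arr j k).toReal * (k : ℝ) ^ 2)
    -- the state-independent policy
    (pω : PMF (Schedule J K))
    -- the state space, on which the chain is irreducible
    (𝒳 : Set (State J))
    (h𝒳 : 𝒳 ⊆ State.vectors (ch.quantum ρ) (serviceRequirement ρ M pe))
    (hne : 𝒳.Nonempty)
    (hclosed : MChain.Closed (queueChain (ch.quantum ρ) (serviceRequirement ρ M pe) arr
      (stateIndependentPolicy pω)) 𝒳)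
    (hirr : MChain.Irreducible (MChain.restrict _ 𝒳 hclosed))
    -- the stability condition
    (hstab : ∀ j, (serviceRequirement ρ M pe j + maxQuantum (ch.quantum ρ) j) *
        batchMean (arr j) < ∑ s, (pω s).toReal * ((s.1 j : ℝ) * ch.quantum ρ s j)) :
    MChain.CRegular (MChain.restrict _ 𝒳 hclosed)
        (fun α : 𝒳 => ENNReal.ofReal (costFun (ch.quantum ρ) α.1)) ∧
      MChain.Stable (MChain.restrict _ 𝒳 hclosed) (fun α : 𝒳 => State.size α.1) := by
  have hφ : IsQuantum (ch.quantum ρ) := by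
    cases ch with
    | discrete c =>
      exact ⟨fun _ _ hs => c.quantum_eq_zero ρ hs, hpos c rfl, hmono c rfl⟩
    | gaussian c => exact c.isQuantum hρ
  exact hφ.cRegular_and_stable hS hK harr pω hstab h𝒳 hne hclosed hirr
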